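/- Let $E$ be a 2-polygraph: a set $E_0$ of 0-generators, a set $E_1$ of 1-generators $f:A\to B$ with $A,B\in E_0$, and a set $E_2$ of 2-generators $\alpha:f\Rightarrow g$, where $f,g$ are parallel 1-cells, i.e. paths of 1-generators. Let $E^*$ be the free (strict) 2-category on $E$; we write $\otimes$ for horizontal composition (in diagrammatic order) and $\circ$ for vertical composition. Let $F$ be the following 3-polygraph. * $F_0=E_0$. * $F_1=\{f^n : f\in E_1,\ n\in\mathbb Z\}$, where, for $f:A\to B$ in $E_1$, $f^n:A\to B$ if $n$ is even and $f^n:B\to A$ if $n$ is odd; $n$ is called the winding number. * $F_2$ consists of a generator $\alpha^0:f^0\Rightarrow g^0$ for each $\alpha:f\Rightarrow g$ in $E_2$, and of generators $\eta_{f^n}:\mathrm{id}_B\Rightarrow f^{n-1}\otimes f^n$ and $\varepsilon_{f^n}:f^n\otimes f^{n-1}\Rightarrow \mathrm{id}_A$ for each $f^n:A\to B$ in $F_1$. Here, for a 1-cell $f=a_1\otimes\cdots\otimes a_p$ of $E^*$ with $a_i\in E_1$, we write $f^0=a_1^0\otimes\cdots\otimes a_p^0$; thus $(f_1\otimes\cdots\otimes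 f_m)^0=f_1^0\otimes\cdots\otimes f_m^0$. * $F_3$ consists, for each $f^n\in F_1$, of the rewriting rules $$l_{f^n}:(f^{n-1}\otimes\varepsilon_{f^n})\circ(\eta_{f^n}\otimes f^{n-1})\Rrightarrow f^{n-1},\qquad r_{f^n}:(\varepsilon_{f^n}\otimes f^n)\circ(f^n\otimes\eta_{f^n})\Rrightarrow f^n .$$ Let $F_2^*$ be the set of 2-cells of the free 2-category on the 2-polygraph $(F_0,F_1,F_2)$. A 2-cell $\alpha'\in F_2^*$ rewrites in one step to $\beta'$ if $\alpha'=K(\alpha)$ and $\beta'=K(\beta)$ for some rule $\alpha\Rrightarrow\beta$ in $F_3$ and some unary context $K$ (a 2-cell with one additional 2-generator, a metavariable, occurring exactly once; $K(\alpha)$ is obtained by substituting $\alpha$ for it). A normal form is a 2-cell from which no rewriting step starts. Let $\overline{F^*}$ be the 2-category presented by $F$, i.e. the quotient of this free 2-category by the equivalence relation on 2-cells generated by rewriting. The assignment $A\mapsto A$, $f\mapsto f^0$, $\alpha\mapsto\alpha^0$ (for $\alpha\in E_2$) extends to a 2-functor from $E^*$ to the free 2-category on $(F_0,F_1,F_2)$,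 whose action on all 2-cells is still written $\alpha\mapsto\alpha^0$, and hence to a 2-functor $E^*\to\overline{F^*}$. Then, for all parallel 1-cells $f$ and $g$ of $E^*$ (in particular for $f=f_1\otimes\cdots\otimes f_m$ and $g=g_1\otimes\cdots\otimes g_n$, where $f_1,\dots,f_m$ and $g_1,\dots,g_n$ are parallel lists of composable 1-cells): 1. a 2-cell $f^0\Rightarrow g^0$ in $F_2^*$ which is a normal form does not contain any 2-generator $\eta_{h^k}$ or $\varepsilon_{h^k}$, where $h\in E_1$ and $k\in\mathbb Z$; 2. $\alpha\mapsto\alpha^0$ is a bijection from the 2-cells $f\Rightarrow g$ of $E^*$ to the 2-cells $f^0\Rightarrow g^0$ in $F_2^*$ which are normal forms; 3. the 2-functor $E^*\to\overline{F^*}$ is full and faithful: the induced functors $E^*(A,B)\to\overline{F^*}(A,B)$ are full and faithful for all 0-cells $A$, $B$. -/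

import Mathlib

open CategoryTheory Quiver

universe w w' v v' u u'

/-! ### 2-categories over a free category of 1-cells -/

/-- A (strict) 2-category whose underlying category of 1-cells is the free category on the
quiver `V`: the 0-cells are the vertices, the 1-cells are the paths, horizontal composition of
1-cells is concatenation of paths. `vcomp α β` is the vertical composite "`α`, then `β`" (often
written `β ∘ α`), and `hcomp α β` is the horizontal composite `α ⊗ β`.
Associativity and unitality of `⊗` on 2-cells are heterogeneous equalities, because the two
sides have equal but not syntactically identical boundaries. -/
structure PathTwoCat (V : Type u) [Quiver.{v} V] where
  Cell : ∀ {a b : V}, Path a b → Path a b → Type w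
  id : ∀ {a b : V} (f : Path a b), Cell f f
  vcomp : ∀ {a b : V} {f g h : Path a b}, Cell f g → Cell g h → Cell f h
  hcomp : ∀ {a b c : V} {f f' : Path a b} {g g' : Path b c},
    Cell f f' → Cell g g' → Cell (f.comp g) (f'.comp g')
  id_vcomp : ∀ {a b : V} {f g : Path a b} (α : Cell f g), vcomp (id f) α = α
  vcomp_id : ∀ {a b : V} {f g : Path a b} (α : Cell f g), vcomp α (id g) = α
  vcomp_assoc : ∀ {a b : V} {f g h k : Path a b} (α : Cell f g) (β : Cell g h) (γ : Cell h k),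
    vcomp (vcomp α β) γ = vcomp α (vcomp β γ)
  hcomp_ids : ∀ {a b c : V} (f : Path a b) (g : Path b c),
    hcomp (id f) (id g) = id (f.comp g)
  interchange : ∀ {a b c : V} {f f' f'' : Path a b} {g g' g'' : Path b c}
    (α : Cell f f') (α' : Cell f' f'') (β : Cell g g') (β' : Cell g' g''),
    hcomp (vcomp α α') (vcomp β β') = vcomp (hcomp α β) (hcomp α' β')
  hcomp_assoc : ∀ {a b c d : V} {f f' : Path a b} {g g' : Path b c} {h h' : Path c d}
    (α : Cell f f') (β : Cell g g') (γ : Cell h h'),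
    hcomp (hcomp α β) γ ≍ hcomp α (hcomp β γ)
  id_hcomp : ∀ {a b : V} {f f' : Path a b} (α : Cell f f'),
    hcomp (id (Path.nil : Path a a)) α ≍ α
  hcomp_id : ∀ {a b : V} {f f' : Path a b} (α : Cell f f'),
    hcomp α (id (Path.nil : Path b b)) ≍ α

namespace PathTwoCat

section

variable {V : Type u} [Quiver.{v} V]

/-- The type of 0-cells of a `PathTwoCat`, on which it is a bicategory in Mathlib's sense. -/
@[nolint unusedArguments]
def Obj (_C : PathTwoCat.{w} V) : Type u := V

variable (C : PathTwoCat.{w} V)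

theorem vcomp_heq {a b : V} {f g h f' g' h' : Path a b} (hf : f = f') (hg : g = g') (hh : h = h')
    {α : C.Cell f g} {β : C.Cell g h} {α' : C.Cell f' g'} {β' : C.Cell g' h'}
    (hα : α ≍ α') (hβ : β ≍ β') : C.vcomp α β ≍ C.vcomp α' β' := by
  subst hf hg hh
  rw [eq_of_heq hα, eq_of_heq hβ]

theorem hcomp_heq {a b c : V} {f g f' g' : Path a b} {h k h' k' : Path b c}
    (hf : f = f') (hg : g = g') (hh : h = h') (hk : k = k')
    {α : C.Cell f g} {β : C.Cell h k} {α' : C.Cell f' g'} {β' : C.Cell h' k'}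
    (hα : α ≍ α') (hβ : β ≍ β') : C.hcomp α β ≍ C.hcomp α' β' := by
  subst hf hg hh hk
  rw [eq_of_heq hα, eq_of_heq hβ]

theorem hcomp_id_vcomp {a b c : V} (f : Path a b) {g h k : Path b c} (η : C.Cell g h)
    (θ : C.Cell h k) :
    C.hcomp (C.id f) (C.vcomp η θ) = C.vcomp (C.hcomp (C.id f) η) (C.hcomp (C.id f) θ) := by
  rw [← C.interchange, C.id_vcomp]

theorem hcomp_vcomp_id {a b c : V} {f g h : Path a b} (η : C.Cell f g) (θ : C.Cell g h)
    (k : Path b c) :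
    C.hcomp (C.vcomp η θ) (C.id k) = C.vcomp (C.hcomp η (C.id k)) (C.hcomp θ (C.id k)) := by
  rw [← C.interchange, C.id_vcomp]

theorem exchange {a b c : V} {f g : Path a b} {h k : Path b c} (η : C.Cell f g)
    (θ : C.Cell h k) :
    C.vcomp (C.hcomp (C.id f) θ) (C.hcomp η (C.id k)) =
      C.vcomp (C.hcomp η (C.id h)) (C.hcomp (C.id g) θ) := by
  rw [← C.interchange, ← C.interchange, C.id_vcomp, C.vcomp_id, C.vcomp_id, C.id_vcomp]

theorem hcomp_comp_id_left {a b c d : V} (f : Path a b) (g : Path b c) {h h' : Path c d}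
    (η : C.Cell h h') :
    C.hcomp (C.id (f.comp g)) η ≍ C.hcomp (C.id f) (C.hcomp (C.id g) η) := by
  rw [← C.hcomp_ids]; exact C.hcomp_assoc _ _ _

theorem hcomp_comp_id_right {a b c d : V} {f f' : Path a b} (η : C.Cell f f') (g : Path b c)
    (h : Path c d) :
    C.hcomp η (C.id (g.comp h)) ≍ C.hcomp (C.hcomp η (C.id g)) (C.id h) := by
  rw [← C.hcomp_ids]; exact (C.hcomp_assoc _ _ _).symm

instance : CategoryStruct.{max u v} C.Obj where
  Hom a b := @Path V _ a b
  id a := @Path.nil V _ a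
  comp f g := @Path.comp V _ _ _ _ f g

instance homCategory (a b : C.Obj) : Category.{w} (a ⟶ b) where
  Hom f g := C.Cell f g
  id f := C.id f
  comp α β := C.vcomp α β
  id_comp α := C.id_vcomp α
  comp_id α := C.vcomp_id α
  assoc α β γ := C.vcomp_assoc α β γ

theorem eqToHom_heq {a b : C.Obj} {f g : a ⟶ b} (h : f = g) : eqToHom h ≍ 𝟙 f := by
  subst h; rfl

theorem conj_heq {a b : C.Obj} {f g f' g' : a ⟶ b} (hf : f' = f) (hg : g = g') (α : f ⟶ g) :
    eqToHom hf ≫ α ≫ eqToHom hg ≍ α := by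
  subst hf hg; simp

theorem hcomp_eqToHom_id {a b c : C.Obj} {f g : a ⟶ b} (h : f = g) (k : b ⟶ c) :
    C.hcomp (eqToHom h : f ⟶ g) (C.id k) =
      (eqToHom (congrArg (· ≫ k) h) : f ≫ k ⟶ g ≫ k) := by
  subst h; exact C.hcomp_ids f k

theorem hcomp_id_eqToHom {a b c : C.Obj} (k : a ⟶ b) {f g : b ⟶ c} (h : f = g) :
    C.hcomp (C.id k) (eqToHom h : f ⟶ g) =
      (eqToHom (congrArg (k ≫ ·) h) : k ≫ f ⟶ k ≫ g) := by
  subst h; exact C.hcomp_ids k f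

instance : Bicategory.{w} C.Obj where
  homCategory a b := C.homCategory a b
  whiskerLeft f _ _ β := C.hcomp (C.id f) β
  whiskerRight α h := C.hcomp α (C.id h)
  associator f g h := eqToIso (Path.comp_assoc f g h)
  leftUnitor f := eqToIso (Path.nil_comp f)
  rightUnitor f := eqToIso (Path.comp_nil f)
  whiskerLeft_id f g := C.hcomp_ids f g
  whiskerLeft_comp f _ _ _ η θ := C.hcomp_id_vcomp f η θ
  id_whiskerLeft {_ _ f g} η := eq_of_heq <|
    (C.id_hcomp η).trans (C.conj_heq (Path.nil_comp f) (Path.nil_comp g).symm η).symm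
  comp_whiskerLeft {_ _ _ _} f g {h h'} η := eq_of_heq <|
    (C.hcomp_comp_id_left f g η).trans
      (C.conj_heq (Path.comp_assoc f g h) (Path.comp_assoc f g h').symm _).symm
  id_whiskerRight f g := C.hcomp_ids f g
  comp_whiskerRight η θ i := C.hcomp_vcomp_id η θ i
  whiskerRight_id {_ _ f g} η := eq_of_heq <|
    (C.hcomp_id η).trans (C.conj_heq (Path.comp_nil f) (Path.comp_nil g).symm η).symm
  whiskerRight_comp {_ _ _ _ f f'} η g h := eq_of_heq <|
    (C.hcomp_comp_id_right η g h).trans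
      (C.conj_heq (Path.comp_assoc f g h).symm (Path.comp_assoc f' g h) _).symm
  whisker_assoc {_ _ _ _} f {g g'} η h := eq_of_heq <|
    (C.hcomp_assoc (C.id f) η (C.id h)).trans
      (C.conj_heq (Path.comp_assoc f g h) (Path.comp_assoc f g' h).symm _).symm
  whisker_exchange η θ := C.exchange η θ
  pentagon {_ _ _ _ _} f g h i := by
    simp only [eqToIso.hom, hcomp_eqToHom_id, hcomp_id_eqToHom, eqToHom_trans]
  triangle {_ _ _} f g := by
    simp only [eqToIso.hom, hcomp_eqToHom_id, hcomp_id_eqToHom, eqToHom_trans]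

instance : Bicategory.Strict C.Obj where
  id_comp f := Path.nil_comp f
  comp_id f := Path.comp_nil f
  assoc f g h := Path.comp_assoc f g h
  leftUnitor_eqToIso _ := rfl
  rightUnitor_eqToIso _ := rfl
  associator_eqToIso _ _ _ := rfl

/-- Transport of a 2-cell along equalities of 1-cells. -/
def castCell {a b : V} {f g f' g' : Path a b} (hf : f = f') (hg : g = g') (α : C.Cell f g) :
    C.Cell f' g' :=
  hf ▸ hg ▸ α

theorem castCell_heq {a b : V} {f g f' g' : Path a b} (hf : f = f') (hg : g = g')
    (α : C.Cell f g) : C.castCell hf hg α ≍ α := by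
  subst hf hg; rfl

variable {W : Type u'} [Quiver.{v'} W] (D : PathTwoCat.{w} W)

/-- Given a morphism of graphs `φ : V → W`, the 2-category on `V` whose 2-cells `f ⇒ g` are the
2-cells `φ f ⇒ φ g` of `D`. -/
def comap (φ : V ⥤q W) : PathTwoCat.{w} V where
  Cell f g := D.Cell (φ.mapPath f) (φ.mapPath g)
  id f := D.id (φ.mapPath f)
  vcomp α β := D.vcomp α β
  hcomp α β := D.castCell (φ.mapPath_comp _ _).symm (φ.mapPath_comp _ _).symm (D.hcomp α β)
  id_vcomp α := D.id_vcomp α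
  vcomp_id α := D.vcomp_id α
  vcomp_assoc α β γ := D.vcomp_assoc α β γ
  hcomp_ids f g := by
    rw [D.hcomp_ids]
    refine eq_of_heq ((D.castCell_heq _ _ _).trans ?_)
    rw [φ.mapPath_comp]
  interchange {_ _ _ f f' f'' g g' g''} α α' β β' := by
    rw [D.interchange]
    exact eq_of_heq ((D.castCell_heq _ _ _).trans
      (D.vcomp_heq (φ.mapPath_comp f g).symm (φ.mapPath_comp f' g').symm
        (φ.mapPath_comp f'' g'').symm (D.castCell_heq _ _ _).symm (D.castCell_heq _ _ _).symm))
  hcomp_assoc {_ _ _ _ f f' g g' h h'} α β γ := by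
    refine (D.castCell_heq _ _ _).trans (HEq.trans ?_ (D.castCell_heq _ _ _).symm)
    refine (D.hcomp_heq (φ.mapPath_comp f g) (φ.mapPath_comp f' g') rfl rfl
      (D.castCell_heq _ _ _) HEq.rfl).trans ?_
    refine (D.hcomp_assoc α β γ).trans ?_
    exact (D.hcomp_heq rfl rfl (φ.mapPath_comp g h) (φ.mapPath_comp g' h') HEq.rfl
      (D.castCell_heq _ _ _)).symm
  id_hcomp α := (D.castCell_heq _ _ _).trans (D.id_hcomp α)
  hcomp_id α := (D.castCell_heq _ _ _).trans (D.hcomp_id α)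

end

end PathTwoCat

/-! ### Polygraphs and the free 2-category on a 2-polygraph -/

/-- A 2-polygraph `E` whose 0-generators are the elements of `V` and whose 1-generators are the
arrows of the quiver `V`. The 1-cells of the free category are the paths in `V`, and `E.Gen f g`
is the set of 2-generators with source `f` and target `g`. -/
structure TwoPolygraph (V : Type u) [Quiver.{v} V] where
  Gen : ∀ {a b : V}, Path a b → Path a b → Type w

namespace TwoPolygraph

section

variable {V : Type u} [Quiver.{v} V]

/-- Formal vertical and horizontal composites of 2-generators. -/
inductive Term (E : TwoPolygraph.{w} V) : ∀ {a b : V}, Path a b → Path a b → Type (max u v w)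
  | gen {a b : V} {f g : Path a b} (α : E.Gen f g) : Term E f g
  | id {a b : V} (f : Path a b) : Term E f f
  | vcomp {a b : V} {f g h : Path a b} (s : Term E f g) (t : Term E g h) : Term E f h
  | hcomp {a b c : V} {f f' : Path a b} {g g' : Path b c} (s : Term E f f') (t : Term E g g') :
      Term E (f.comp g) (f'.comp g')

/-- The congruence on formal composites generated by the axioms of 2-categories. It is a relation
between terms with possibly different boundaries; related terms have in fact equal boundaries
(`Term.Rel.boundary_eq`). -/
inductive Term.Rel {E : TwoPolygraph.{w} V} :
    ∀ {a b : V} {f g f' g' : Path a b}, E.Term f g → E.Term f' g' → Prop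
  | refl {a b : V} {f g : Path a b} (s : E.Term f g) : Rel s s
  | symm {a b : V} {f g f' g' : Path a b} {s : E.Term f g} {t : E.Term f' g'} :
      Rel s t → Rel t s
  | trans {a b : V} {f g f' g' f'' g'' : Path a b} {s : E.Term f g} {t : E.Term f' g'}
      {r : E.Term f'' g''} : Rel s t → Rel t r → Rel s r
  | vcomp_congr {a b : V} {f g h f' g' h' : Path a b} {s : E.Term f g} {t : E.Term g h}
      {s' : E.Term f' g'} {t' : E.Term g' h'} :
      Rel s s' → Rel t t' → Rel (s.vcomp t) (s'.vcomp t')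
  | hcomp_congr {a b c : V} {f g f' g' : Path a b} {h k h' k' : Path b c} {s : E.Term f g}
      {t : E.Term h k} {s' : E.Term f' g'} {t' : E.Term h' k'} :
      Rel s s' → Rel t t' → Rel (s.hcomp t) (s'.hcomp t')
  | id_vcomp {a b : V} {f g : Path a b} (s : E.Term f g) : Rel ((Term.id f).vcomp s) s
  | vcomp_id {a b : V} {f g : Path a b} (s : E.Term f g) : Rel (s.vcomp (Term.id g)) s
  | vcomp_assoc {a b : V} {f g h k : Path a b} (s : E.Term f g) (t : E.Term g h)
      (r : E.Term h k) : Rel ((s.vcomp t).vcomp r) (s.vcomp (t.vcomp r))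
  | hcomp_ids {a b c : V} (f : Path a b) (g : Path b c) :
      Rel ((Term.id f).hcomp (Term.id g)) (Term.id (f.comp g))
  | interchange {a b c : V} {f f' f'' : Path a b} {g g' g'' : Path b c} (s : E.Term f f')
      (s' : E.Term f' f'') (t : E.Term g g') (t' : E.Term g' g'') :
      Rel ((s.vcomp s').hcomp (t.vcomp t')) ((s.hcomp t).vcomp (s'.hcomp t'))
  | hcomp_assoc {a b c d : V} {f f' : Path a b} {g g' : Path b c} {h h' : Path c d}
      (s : E.Term f f') (t : E.Term g g') (r : E.Term h h') :
      Rel ((s.hcomp t).hcomp r) (s.hcomp (t.hcomp r))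
  | id_hcomp {a b : V} {f f' : Path a b} (s : E.Term f f') :
      Rel ((Term.id (Path.nil : Path a a)).hcomp s) s
  | hcomp_id {a b : V} {f f' : Path a b} (s : E.Term f f') :
      Rel (s.hcomp (Term.id (Path.nil : Path b b))) s

theorem Term.Rel.boundary_eq {E : TwoPolygraph.{w} V} {a b : V} {f g f' g' : Path a b}
    {s : E.Term f g} {t : E.Term f' g'} (h : Term.Rel s t) : f = f' ∧ g = g' := by
  induction h with
  | symm _ ih => exact ⟨ih.1.symm, ih.2.symm⟩
  | trans _ _ ih ih' => exact ⟨ih.1.trans ih'.1, ih.2.trans ih'.2⟩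
  | vcomp_congr _ _ ih ih' => exact ⟨ih.1, ih'.2⟩
  | hcomp_congr _ _ ih ih' => rw [ih.1, ih.2, ih'.1, ih'.2]; exact ⟨rfl, rfl⟩
  | hcomp_assoc => simp
  | id_hcomp => simp
  | _ => exact ⟨rfl, rfl⟩

/-- The 2-cells of the free 2-category: formal composites modulo the axioms of 2-categories. -/
def FreeCell (E : TwoPolygraph.{w} V) {a b : V} (f g : Path a b) : Type (max u v w) :=
  Quot fun s t : E.Term f g => Term.Rel s t

theorem Term.Rel.mk_heq {E : TwoPolygraph.{w} V} {a b : V} {f g f' g' : Path a b}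
    {s : E.Term f g} {t : E.Term f' g'} (h : Term.Rel s t) :
    (Quot.mk _ s : E.FreeCell f g) ≍ (Quot.mk _ t : E.FreeCell f' g') := by
  obtain ⟨rfl, rfl⟩ := h.boundary_eq
  exact heq_of_eq (Quot.sound h)

/-- The free 2-category `E^*` on a 2-polygraph `E`. -/
def free (E : TwoPolygraph.{w} V) : PathTwoCat.{max u v w} V where
  Cell f g := E.FreeCell f g
  id f := Quot.mk _ (Term.id f)
  vcomp := Quot.map₂ Term.vcomp (fun s _ _ h => (Term.Rel.refl s).vcomp_congr h)
    (fun _ _ t h => h.vcomp_congr (Term.Rel.refl t))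
  hcomp := Quot.map₂ Term.hcomp (fun s _ _ h => (Term.Rel.refl s).hcomp_congr h)
    (fun _ _ t h => h.hcomp_congr (Term.Rel.refl t))
  id_vcomp := by rintro _ _ _ _ ⟨s⟩; exact Quot.sound (.id_vcomp s)
  vcomp_id := by rintro _ _ _ _ ⟨s⟩; exact Quot.sound (.vcomp_id s)
  vcomp_assoc := by rintro _ _ _ _ _ _ ⟨s⟩ ⟨t⟩ ⟨r⟩; exact Quot.sound (.vcomp_assoc s t r)
  hcomp_ids f g := Quot.sound (.hcomp_ids f g)
  interchange := by
    rintro _ _ _ _ _ _ _ _ _ ⟨s⟩ ⟨s'⟩ ⟨t⟩ ⟨t'⟩; exact Quot.sound (.interchange s s' t t')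
  hcomp_assoc := by
    rintro _ _ _ _ _ _ _ _ _ _ ⟨s⟩ ⟨t⟩ ⟨r⟩; exact (Term.Rel.hcomp_assoc s t r).mk_heq
  id_hcomp := by rintro _ _ _ _ ⟨s⟩; exact (Term.Rel.id_hcomp s).mk_heq
  hcomp_id := by rintro _ _ _ _ ⟨s⟩; exact (Term.Rel.hcomp_id s).mk_heq

/-- A 2-generator, seen as a 2-cell of the free 2-category. -/
def of (E : TwoPolygraph.{w} V) {a b : V} {f g : Path a b} (α : E.Gen f g) : E.free.Cell f g :=
  Quot.mk _ (Term.gen α)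

/-- Evaluation of a formal composite in a 2-category, given the images of the 2-generators. -/
def Term.eval {E : TwoPolygraph.{w} V} (C : PathTwoCat.{w'} V)
    (σ : ∀ {a b : V} {f g : Path a b}, E.Gen f g → C.Cell f g) :
    ∀ {a b : V} {f g : Path a b}, E.Term f g → C.Cell f g
  | _, _, _, _, .gen α => σ α
  | _, _, _, _, .id f => C.id f
  | _, _, _, _, .vcomp s t => C.vcomp (s.eval C σ) (t.eval C σ)
  | _, _, _, _, .hcomp s t => C.hcomp (s.eval C σ) (t.eval C σ)

theorem Term.Rel.eval_heq {E : TwoPolygraph.{w} V} (C : PathTwoCat.{w'} V)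
    (σ : ∀ {a b : V} {f g : Path a b}, E.Gen f g → C.Cell f g) {a b : V}
    {f g f' g' : Path a b} {s : E.Term f g} {t : E.Term f' g'} (h : Term.Rel s t) :
    s.eval C σ ≍ t.eval C σ := by
  induction h with
  | refl => rfl
  | symm _ ih => exact ih.symm
  | trans _ _ ih ih' => exact ih.trans ih'
  | vcomp_congr h h' ih ih' =>
    exact C.vcomp_heq h.boundary_eq.1 h.boundary_eq.2 h'.boundary_eq.2 ih ih'
  | hcomp_congr h h' ih ih' =>
    exact C.hcomp_heq h.boundary_eq.1 h.boundary_eq.2 h'.boundary_eq.1 h'.boundary_eq.2 ih ih'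
  | id_vcomp => exact heq_of_eq (C.id_vcomp _)
  | vcomp_id => exact heq_of_eq (C.vcomp_id _)
  | vcomp_assoc => exact heq_of_eq (C.vcomp_assoc _ _ _)
  | hcomp_ids => exact heq_of_eq (C.hcomp_ids _ _)
  | interchange => exact heq_of_eq (C.interchange _ _ _ _)
  | hcomp_assoc => exact C.hcomp_assoc _ _ _
  | id_hcomp => exact C.id_hcomp _
  | hcomp_id => exact C.hcomp_id _

/-- The universal property of the free 2-category: the 2-functor `E^* → C` which is the identity
on 0-cells and on 1-cells and sends each 2-generator `α` to `σ α`. -/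
def eval {E : TwoPolygraph.{w} V} (C : PathTwoCat.{w'} V)
    (σ : ∀ {a b : V} {f g : Path a b}, E.Gen f g → C.Cell f g) {a b : V} {f g : Path a b} :
    E.free.Cell f g → C.Cell f g :=
  Quot.lift (fun s => s.eval C σ) fun _ _ h => eq_of_heq (h.eval_heq C σ)

theorem eval_vcomp {E : TwoPolygraph.{w} V} (C : PathTwoCat.{w'} V)
    (σ : ∀ {a b : V} {f g : Path a b}, E.Gen f g → C.Cell f g) {a b : V} {f g h : Path a b}
    (α : E.free.Cell f g) (β : E.free.Cell g h) :
    eval C σ (E.free.vcomp α β) = C.vcomp (eval C σ α) (eval C σ β) := by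
  obtain ⟨s⟩ := α; obtain ⟨t⟩ := β; rfl

theorem eval_hcomp {E : TwoPolygraph.{w} V} (C : PathTwoCat.{w'} V)
    (σ : ∀ {a b : V} {f g : Path a b}, E.Gen f g → C.Cell f g) {a b c : V} {f f' : Path a b}
    {g g' : Path b c} (α : E.free.Cell f f') (β : E.free.Cell g g') :
    eval C σ (E.free.hcomp α β) = C.hcomp (eval C σ α) (eval C σ β) := by
  obtain ⟨s⟩ := α; obtain ⟨t⟩ := β; rfl

/-- The universal property of the free 2-category, with respect to 2-functors which need not be the
identity on 0-cells and 1-cells: given a morphism `φ` of graphs and, for each 2-generator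
`α : f ⇒ g`, a 2-cell `σ α : φ f ⇒ φ g` of `C`, the induced 2-functor `E^* → C`. -/
def lift {W : Type u'} [Quiver.{v'} W] {E : TwoPolygraph.{w} V} (φ : V ⥤q W)
    (C : PathTwoCat.{w'} W)
    (σ : ∀ {a b : V} {f g : Path a b}, E.Gen f g → C.Cell (φ.mapPath f) (φ.mapPath g)) :
    StrictPseudofunctor E.free.Obj C.Obj :=
  StrictPseudofunctor.mk''
    { obj := fun a => φ.obj a
      map := fun f => φ.mapPath f
      map₂ := fun α => eval (C.comap φ) σ α
      map₂_id := fun _ => rfl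
      map₂_comp := fun α β => eval_vcomp (C.comap φ) σ α β
      map_id := fun _ => rfl
      map_comp := fun f g => φ.mapPath_comp f g
      map₂_whisker_left := fun {_ _ _} f {g g'} η => by
        refine (eval_hcomp (C.comap φ) σ (E.free.id f) η).trans (eq_of_heq ?_)
        exact (C.castCell_heq _ _ _).trans
          (C.conj_heq (φ.mapPath_comp f g) (φ.mapPath_comp f g').symm _).symm
      map₂_whisker_right := fun {_ _ _ f f'} η g => by
        refine (eval_hcomp (C.comap φ) σ η (E.free.id g)).trans (eq_of_heq ?_)
        exact (C.castCell_heq _ _ _).trans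
          (C.conj_heq (φ.mapPath_comp f g) (φ.mapPath_comp f' g).symm _).symm }

/-! ### Weights, contexts and rewriting -/

/-- The 2-category with natural numbers as 2-cells, both compositions being addition. -/
def additive (V : Type u) [Quiver.{v} V] : PathTwoCat.{0} V where
  Cell _ _ := ℕ
  id _ := 0
  vcomp m n := m + n
  hcomp m n := m + n
  id_vcomp := Nat.zero_add
  vcomp_id := Nat.add_zero
  vcomp_assoc := Nat.add_assoc
  hcomp_ids _ _ := rfl
  interchange := Nat.add_add_add_comm
  hcomp_assoc _ _ _ := heq_of_eq (Nat.add_assoc _ _ _)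
  id_hcomp _ := heq_of_eq (Nat.zero_add _)
  hcomp_id _ := heq_of_eq (Nat.add_zero _)

/-- The weight of a 2-cell: each occurrence of a 2-generator `α` counts for `φ α`. -/
def weight {E : TwoPolygraph.{w} V} (φ : ∀ {a b : V} {f g : Path a b}, E.Gen f g → ℕ) {a b : V}
    {f g : Path a b} (β : E.free.Cell f g) : ℕ :=
  eval (additive V) φ β

/-- The 2-generators of `E[f ⇒ g]`: those of `E` and a metavariable `X : f ⇒ g`. -/
inductive AdjoinGen (E : TwoPolygraph.{w} V) {a b : V} (f g : Path a b) :
    ∀ {c d : V}, Path c d → Path c d → Type (max u v w)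
  | old {c d : V} {h k : Path c d} (α : E.Gen h k) : AdjoinGen E f g h k
  | var : AdjoinGen E f g f g

/-- The 2-polygraph `E[f ⇒ g]`. -/
abbrev adjoin (E : TwoPolygraph.{w} V) {a b : V} (f g : Path a b) :
    TwoPolygraph.{max u v w} V where
  Gen h k := E.AdjoinGen f g h k

/-- The indicator function of the metavariable. -/
def isVar {E : TwoPolygraph.{w} V} {a b : V} {f g : Path a b} {c d : V} {h k : Path c d} :
    (E.adjoin f g).Gen h k → ℕ
  | AdjoinGen.old _ => 0
  | AdjoinGen.var => 1

/-- The interpretation of generators of `E[f ⇒ g]` in `E^*` sending the metavariable to `α`. -/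
def substVar {E : TwoPolygraph.{w} V} {a b : V} {f g : Path a b} (α : E.free.Cell f g)
    {c d : V} {h k : Path c d} : (E.adjoin f g).Gen h k → E.free.Cell h k
  | AdjoinGen.old β => E.of β
  | AdjoinGen.var => α

/-- A unary context `K : (f ⇒ g) → (h ⇒ k)`: a 2-cell `h ⇒ k` of `E[f ⇒ g]^*` in which the
metavariable occurs exactly once. -/
structure Context (E : TwoPolygraph.{w} V) {a b : V} (f g : Path a b) {c d : V}
    (h k : Path c d) where
  cell : (E.adjoin f g).free.Cell h k
  weight_var : weight isVar cell = 1

/-- `K(α)`: the metavariable of the context `K` is replaced by `α`. -/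
def Context.apply {E : TwoPolygraph.{w} V} {a b : V} {f g : Path a b} {c d : V}
    {h k : Path c d} (K : E.Context f g h k) (α : E.free.Cell f g) : E.free.Cell h k :=
  eval E.free (substVar α) K.cell

/-- The inclusion `E^* → E[f ⇒ g]^*`. -/
def incl {E : TwoPolygraph.{w} V} {a b : V} (f g : Path a b) {c d : V} {h k : Path c d}
    (β : E.free.Cell h k) : (E.adjoin f g).free.Cell h k :=
  eval (E.adjoin f g).free (fun α => (E.adjoin f g).of (AdjoinGen.old α)) β

theorem incl_vcomp {E : TwoPolygraph.{w} V} {a b : V} (f g : Path a b) {c d : V}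
    {h k l : Path c d} (β : E.free.Cell h k) (γ : E.free.Cell k l) :
    incl f g (E.free.vcomp β γ) = (E.adjoin f g).free.vcomp (incl f g β) (incl f g γ) :=
  eval_vcomp _ _ β γ

theorem incl_hcomp {E : TwoPolygraph.{w} V} {a b : V} (f g : Path a b) {c d e : V}
    {h h' : Path c d} {k k' : Path d e} (β : E.free.Cell h h') (γ : E.free.Cell k k') :
    incl f g (E.free.hcomp β γ) = (E.adjoin f g).free.hcomp (incl f g β) (incl f g γ) :=
  eval_hcomp _ _ β γ

theorem weight_vcomp {E : TwoPolygraph.{w} V}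
    (φ : ∀ {a b : V} {f g : Path a b}, E.Gen f g → ℕ) {c d : V}
    {h k l : Path c d} (β : E.free.Cell h k) (γ : E.free.Cell k l) :
    weight φ (E.free.vcomp β γ) = weight φ β + weight φ γ :=
  eval_vcomp _ _ β γ

theorem weight_hcomp {E : TwoPolygraph.{w} V}
    (φ : ∀ {a b : V} {f g : Path a b}, E.Gen f g → ℕ) {c d e : V}
    {h h' : Path c d} {k k' : Path d e} (β : E.free.Cell h h') (γ : E.free.Cell k k') :
    weight φ (E.free.hcomp β γ) = weight φ β + weight φ γ :=
  eval_hcomp _ _ β γ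

theorem weight_incl {E : TwoPolygraph.{w} V} {a b : V} (f g : Path a b) {c d : V}
    {h k : Path c d} (β : E.free.Cell h k) :
    weight isVar (incl f g β) = 0 := by
  obtain ⟨t⟩ := β
  induction t with
  | gen => rfl
  | id => rfl
  | vcomp s t hs ht =>
    refine (congrArg (weight _) (incl_vcomp f g (Quot.mk _ s) (Quot.mk _ t))).trans ?_
    rw [weight_vcomp, hs (Quot.mk _ s), ht (Quot.mk _ t)]
  | hcomp s t hs ht =>
    refine (congrArg (weight _) (incl_hcomp f g (Quot.mk _ s) (Quot.mk _ t))).trans ?_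
    rw [weight_hcomp, hs (Quot.mk _ s), ht (Quot.mk _ t)]

theorem eval_subst_incl {E : TwoPolygraph.{w} V} {a b : V} {f g : Path a b}
    (α : E.free.Cell f g) {c d : V} {h k : Path c d} (β : E.free.Cell h k) :
    eval E.free (substVar α) (incl f g β) = β := by
  obtain ⟨t⟩ := β
  induction t with
  | gen => rfl
  | id => rfl
  | vcomp s t hs ht =>
    refine (congrArg (eval _ _) (incl_vcomp f g (Quot.mk _ s) (Quot.mk _ t))).trans ?_
    rw [eval_vcomp, hs (Quot.mk _ s), ht (Quot.mk _ t)]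
    rfl
  | hcomp s t hs ht =>
    refine (congrArg (eval _ _) (incl_hcomp f g (Quot.mk _ s) (Quot.mk _ t))).trans ?_
    rw [eval_hcomp, hs (Quot.mk _ s), ht (Quot.mk _ t)]
    rfl

/-- The context `K ∘ γ`. -/
def Context.vcompLeft {E : TwoPolygraph.{w} V} {a b : V} {f g : Path a b} {c d : V}
    {h k l : Path c d} (γ : E.free.Cell h k) (K : E.Context f g k l) : E.Context f g h l where
  cell := (E.adjoin f g).free.vcomp (incl f g γ) K.cell
  weight_var := by rw [weight_vcomp, weight_incl, K.weight_var]

/-- The context `γ ∘ K`. -/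
def Context.vcompRight {E : TwoPolygraph.{w} V} {a b : V} {f g : Path a b} {c d : V}
    {h k l : Path c d} (K : E.Context f g h k) (γ : E.free.Cell k l) : E.Context f g h l where
  cell := (E.adjoin f g).free.vcomp K.cell (incl f g γ)
  weight_var := by rw [weight_vcomp, weight_incl, K.weight_var]

/-- The context `γ ⊗ K`. -/
def Context.hcompLeft {E : TwoPolygraph.{w} V} {a b : V} {f g : Path a b} {c d e : V}
    {h h' : Path c d} {k k' : Path d e} (γ : E.free.Cell h h') (K : E.Context f g k k') :
    E.Context f g (h.comp k) (h'.comp k') where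
  cell := (E.adjoin f g).free.hcomp (incl f g γ) K.cell
  weight_var := by rw [weight_hcomp, weight_incl, K.weight_var]

/-- The context `K ⊗ γ`. -/
def Context.hcompRight {E : TwoPolygraph.{w} V} {a b : V} {f g : Path a b} {c d e : V}
    {h h' : Path c d} {k k' : Path d e} (K : E.Context f g h h') (γ : E.free.Cell k k') :
    E.Context f g (h.comp k) (h'.comp k') where
  cell := (E.adjoin f g).free.hcomp K.cell (incl f g γ)
  weight_var := by rw [weight_hcomp, weight_incl, K.weight_var]

theorem Context.apply_vcompLeft {E : TwoPolygraph.{w} V} {a b : V} {f g : Path a b} {c d : V}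
    {h k l : Path c d} (γ : E.free.Cell h k) (K : E.Context f g k l) (α : E.free.Cell f g) :
    (K.vcompLeft γ).apply α = E.free.vcomp γ (K.apply α) := by
  rw [apply, vcompLeft, eval_vcomp, eval_subst_incl, apply]

theorem Context.apply_vcompRight {E : TwoPolygraph.{w} V} {a b : V} {f g : Path a b} {c d : V}
    {h k l : Path c d} (K : E.Context f g h k) (γ : E.free.Cell k l) (α : E.free.Cell f g) :
    (K.vcompRight γ).apply α = E.free.vcomp (K.apply α) γ := by
  rw [apply, vcompRight, eval_vcomp, eval_subst_incl, apply]

theorem Context.apply_hcompLeft {E : TwoPolygraph.{w} V} {a b : V} {f g : Path a b}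
    {c d e : V} {h h' : Path c d} {k k' : Path d e} (γ : E.free.Cell h h')
    (K : E.Context f g k k') (α : E.free.Cell f g) :
    (K.hcompLeft γ).apply α = E.free.hcomp γ (K.apply α) := by
  rw [apply, hcompLeft, eval_hcomp, eval_subst_incl, apply]

theorem Context.apply_hcompRight {E : TwoPolygraph.{w} V} {a b : V} {f g : Path a b}
    {c d e : V} {h h' : Path c d} {k k' : Path d e} (K : E.Context f g h h')
    (γ : E.free.Cell k k') (α : E.free.Cell f g) :
    (K.hcompRight γ).apply α = E.free.hcomp (K.apply α) γ := by
  rw [apply, hcompRight, eval_hcomp, eval_subst_incl, apply]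

end

end TwoPolygraph

/-- A 3-polygraph on the graph `V`: a 2-polygraph together with, for each pair of parallel
2-cells `α`, `β` of the free 2-category, a set `Gen₃ α β` of 3-generators (rewriting rules)
from `α` to `β`. -/
structure ThreePolygraph (V : Type u) [Quiver.{v} V] extends TwoPolygraph.{w} V where
  Gen₃ : ∀ {a b : V} {f g : Path a b},
    toTwoPolygraph.free.Cell f g → toTwoPolygraph.free.Cell f g → Type w

namespace ThreePolygraph

section

variable {V : Type u} [Quiver.{v} V]

/-- One-step rewriting: `α'` rewrites to `β'` if `α' = K(α)` and `β' = K(β)` for some 3-generator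
from `α` to `β` and some unary context `K`. -/
inductive Step (F : ThreePolygraph.{w} V) {c d : V} {h k : Path c d} :
    F.free.Cell h k → F.free.Cell h k → Prop
  | mk {a b : V} {f g : Path a b} {α β : F.free.Cell f g} (r : F.Gen₃ α β)
      (K : F.Context f g h k) : Step F (K.apply α) (K.apply β)

/-- A 2-cell is a normal form if no rewriting step starts from it. -/
def IsNormalForm (F : ThreePolygraph.{w} V) {c d : V} {h k : Path c d}
    (α : F.free.Cell h k) : Prop :=
  ∀ β : F.free.Cell h k, ¬ F.Step α β

theorem Step.vcomp_left {F : ThreePolygraph.{w} V} {c d : V} {h k l : Path c d}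
    (γ : F.free.Cell h k) {α β : F.free.Cell k l} (s : F.Step α β) :
    F.Step (F.free.vcomp γ α) (F.free.vcomp γ β) := by
  obtain ⟨r, K⟩ := s
  rw [← TwoPolygraph.Context.apply_vcompLeft, ← TwoPolygraph.Context.apply_vcompLeft]
  exact .mk r _

theorem Step.vcomp_right {F : ThreePolygraph.{w} V} {c d : V} {h k l : Path c d}
    {α β : F.free.Cell h k} (s : F.Step α β) (γ : F.free.Cell k l) :
    F.Step (F.free.vcomp α γ) (F.free.vcomp β γ) := by
  obtain ⟨r, K⟩ := s
  rw [← TwoPolygraph.Context.apply_vcompRight, ← TwoPolygraph.Context.apply_vcompRight]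
  exact .mk r _

theorem Step.hcomp_left {F : ThreePolygraph.{w} V} {c d e : V} {h h' : Path c d}
    {k k' : Path d e} (γ : F.free.Cell h h') {α β : F.free.Cell k k'} (s : F.Step α β) :
    F.Step (F.free.hcomp γ α) (F.free.hcomp γ β) := by
  obtain ⟨r, K⟩ := s
  rw [← TwoPolygraph.Context.apply_hcompLeft, ← TwoPolygraph.Context.apply_hcompLeft]
  exact .mk r _

theorem Step.hcomp_right {F : ThreePolygraph.{w} V} {c d e : V} {h h' : Path c d}
    {k k' : Path d e} {α β : F.free.Cell h h'} (s : F.Step α β) (γ : F.free.Cell k k') :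
    F.Step (F.free.hcomp α γ) (F.free.hcomp β γ) := by
  obtain ⟨r, K⟩ := s
  rw [← TwoPolygraph.Context.apply_hcompRight, ← TwoPolygraph.Context.apply_hcompRight]
  exact .mk r _

theorem mk_heq (F : ThreePolygraph.{w} V) {c d : V} {h k h' k' : Path c d}
    {α : F.free.Cell h k} {β : F.free.Cell h' k'} (hh : h = h') (hk : k = k') (e : α ≍ β) :
    (Quot.mk F.Step α : Quot F.Step) ≍ (Quot.mk F.Step β : Quot F.Step) := by
  subst hh hk
  rw [eq_of_heq e]

/-- The 2-category presented by a 3-polygraph `F`: the free 2-category on the underlying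
2-polygraph, in which two 2-cells are identified when they are related by the equivalence
relation generated by rewriting. -/
def presented (F : ThreePolygraph.{w} V) : PathTwoCat.{max u v w} V where
  Cell {a b} f g := Quot (F.Step (c := a) (d := b) (h := f) (k := g))
  id f := Quot.mk _ (F.free.id f)
  vcomp := Quot.map₂ F.free.vcomp (fun γ _ _ s => s.vcomp_left γ) (fun _ _ γ s => s.vcomp_right γ)
  hcomp := Quot.map₂ F.free.hcomp (fun γ _ _ s => s.hcomp_left γ) (fun _ _ γ s => s.hcomp_right γ)
  id_vcomp := by rintro _ _ _ _ ⟨s⟩; exact congrArg (Quot.mk _) (F.free.id_vcomp s)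
  vcomp_id := by rintro _ _ _ _ ⟨s⟩; exact congrArg (Quot.mk _) (F.free.vcomp_id s)
  vcomp_assoc := by
    rintro _ _ _ _ _ _ ⟨s⟩ ⟨t⟩ ⟨r⟩; exact congrArg (Quot.mk _) (F.free.vcomp_assoc s t r)
  hcomp_ids f g := congrArg (Quot.mk _) (F.free.hcomp_ids f g)
  interchange := by
    rintro _ _ _ _ _ _ _ _ _ ⟨s⟩ ⟨s'⟩ ⟨t⟩ ⟨t'⟩
    exact congrArg (Quot.mk _) (F.free.interchange s s' t t')
  hcomp_assoc := by
    rintro _ _ _ _ _ _ _ _ _ _ ⟨s⟩ ⟨t⟩ ⟨r⟩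
    exact F.mk_heq (Path.comp_assoc _ _ _) (Path.comp_assoc _ _ _) (F.free.hcomp_assoc s t r)
  id_hcomp := by
    rintro _ _ _ _ ⟨s⟩; exact F.mk_heq (Path.nil_comp _) (Path.nil_comp _) (F.free.id_hcomp s)
  hcomp_id := by
    rintro _ _ _ _ ⟨s⟩; exact F.mk_heq (Path.comp_nil _) (Path.comp_nil _) (F.free.hcomp_id s)

end

end ThreePolygraph

/-! ### The 3-polygraph of formal adjoints -/

/-- The 0-generators of the 3-polygraph of formal adjoints: those of the original polygraph. -/
def FormalAdj (V : Type u) : Type u := V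

section

variable {V : Type u} [Quiver.{v} V]

/-- The 1-generators `f^n`, for `f` a 1-generator and `n : ℤ` the winding number: if `f : A → B`,
then `f^n : A → B` for `n` even and `f^n : B → A` for `n` odd. -/
inductive FormalAdj.Arrow : V → V → Type (max u v)
  | even {A B : V} (f : A ⟶ B) (n : ℤ) (hn : Even n) : FormalAdj.Arrow A B
  | odd {A B : V} (f : A ⟶ B) (n : ℤ) (hn : Odd n) : FormalAdj.Arrow B A

instance : Quiver.{max u v} (FormalAdj V) where
  Hom A B := FormalAdj.Arrow (V := V) A B

namespace FormalAdj

/-- `f^n ↦ f^(n-1)`. -/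
def pred {A B : FormalAdj V} : (A ⟶ B) → (B ⟶ A)
  | .even f n hn => .odd f (n - 1) (hn.sub_odd odd_one)
  | .odd f n hn => .even f (n - 1) (hn.sub_odd odd_one)

variable (V) in
/-- `A ↦ A` on 0-generators and `f ↦ f^0` on 1-generators. -/
def zero : V ⥤q FormalAdj V where
  obj A := A
  map f := .even f 0 Even.zero

/-- The 2-generators: `α^0 : f^0 ⇒ g^0` for `α : f ⇒ g` a 2-generator of `E`, and, for every
1-generator `x = f^n : A → B`, a unit `η_x : id_B ⇒ f^(n-1) ⊗ f^n` and a counit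
`ε_x : f^n ⊗ f^(n-1) ⇒ id_A`. -/
inductive Gen₂ (E : TwoPolygraph.{w} V) :
    ∀ {A B : FormalAdj V}, Path A B → Path A B → Type (max u v w)
  | base {A B : V} {f g : Path A B} (α : E.Gen f g) :
      Gen₂ E ((zero V).mapPath f) ((zero V).mapPath g)
  | unit {A B : FormalAdj V} (x : A ⟶ B) :
      Gen₂ E (Path.nil : Path B B) ((pred x).toPath.comp x.toPath)
  | counit {A B : FormalAdj V} (x : A ⟶ B) :
      Gen₂ E (x.toPath.comp (pred x).toPath) (Path.nil : Path A A)

/-- The 2-polygraph underlying `F`. -/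
abbrev twoPolygraph (E : TwoPolygraph.{w} V) : TwoPolygraph.{max u v w} (FormalAdj V) where
  Gen f g := Gen₂ E f g

/-- The unit `η_x`, as a 2-cell. -/
def η (E : TwoPolygraph.{w} V) {A B : FormalAdj V} (x : A ⟶ B) :
    (twoPolygraph E).free.Cell (Path.nil : Path B B) ((pred x).toPath.comp x.toPath) :=
  (twoPolygraph E).of (Gen₂.unit x)

/-- The counit `ε_x`, as a 2-cell. -/
def ε (E : TwoPolygraph.{w} V) {A B : FormalAdj V} (x : A ⟶ B) :
    (twoPolygraph E).free.Cell (x.toPath.comp (pred x).toPath) (Path.nil : Path A A) :=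
  (twoPolygraph E).of (Gen₂.counit x)

/-- The 3-generators, for every 1-generator `x = f^n : A → B`:
`l_x : (f^(n-1) ⊗ ε_x) ∘ (η_x ⊗ f^(n-1)) ⇛ f^(n-1)` and
`r_x : (ε_x ⊗ f^n) ∘ (f^n ⊗ η_x) ⇛ f^n`. -/
inductive Gen₃ (E : TwoPolygraph.{w} V) :
    ∀ {A B : FormalAdj V} {f g : Path A B},
      (twoPolygraph E).free.Cell f g → (twoPolygraph E).free.Cell f g → Type (max u v w)
  | l {A B : FormalAdj V} (x : A ⟶ B) :
      Gen₃ E (f := (pred x).toPath) (g := (pred x).toPath)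
        ((twoPolygraph E).free.vcomp
          ((twoPolygraph E).free.hcomp (η E x) ((twoPolygraph E).free.id (pred x).toPath))
          ((twoPolygraph E).free.hcomp ((twoPolygraph E).free.id (pred x).toPath) (ε E x)))
        ((twoPolygraph E).free.id (pred x).toPath)
  | r {A B : FormalAdj V} (x : A ⟶ B) :
      Gen₃ E (f := x.toPath) (g := x.toPath)
        ((twoPolygraph E).free.vcomp
          ((twoPolygraph E).free.hcomp ((twoPolygraph E).free.id x.toPath) (η E x))
          ((twoPolygraph E).free.hcomp (ε E x) ((twoPolygraph E).free.id x.toPath)))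
        ((twoPolygraph E).free.id x.toPath)

/-- The 3-polygraph `F` presenting the free compact 2-category on `E^*`. -/
abbrev polygraph (E : TwoPolygraph.{w} V) : ThreePolygraph (FormalAdj V) where
  toTwoPolygraph := twoPolygraph E
  Gen₃ α β := Gen₃ E α β

/-- The indicator function of the units and counits. -/
def isUnitOrCounit {E : TwoPolygraph.{w} V} {A B : FormalAdj V} {f g : Path A B} :
    (polygraph E).Gen f g → ℕ
  | Gen₂.base _ => 0
  | Gen₂.unit _ => 1
  | Gen₂.counit _ => 1

/-- The embedding `E^* → F^*` into the underlying 2-category of `F^*`: the identity on 0-cells,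
`f ↦ f^0` on 1-cells, `α ↦ α^0` on 2-cells. -/
def toFree (E : TwoPolygraph.{w} V) :
    StrictPseudofunctor E.free.Obj (polygraph E).free.Obj :=
  TwoPolygraph.lift (zero V) (polygraph E).free fun α => (polygraph E).of (Gen₂.base α)

/-- The embedding of `E^*` into the 2-category presented by `F`: the identity on 0-cells,
`f ↦ f^0` on 1-cells, `α ↦ α^0` on 2-cells. -/
def embedding (E : TwoPolygraph.{w} V) :
    StrictPseudofunctor E.free.Obj (polygraph E).presented.Obj :=
  TwoPolygraph.lift (zero V) (polygraph E).presented fun α =>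
    Quot.mk _ ((polygraph E).of (Gen₂.base α))

/-- The number of occurrences of generators `η_x` and `ε_x` in a 2-cell of `F^*`. -/
def unitCounitCount {E : TwoPolygraph.{w} V} {A B : FormalAdj V} {f g : Path A B}
    (α : (polygraph E).free.Cell f g) : ℕ :=
  TwoPolygraph.weight isUnitOrCounit α

end FormalAdj

end

-- Normal forms. Read 2-cells as string diagrams, and take one whose source and target have only
-- letters of winding number zero and whose units and counits involve only winding numbers in `[-m,
-- n]`, with `n > 0`. If `n` is involved at all, some unit creates a letter `x` of winding number
-- `n`. It cannot reach the target, and generators of `E` do not consume it, so a counit does. The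
-- other leg of that counit cannot have winding number `n + 1`, hence the counit is the one of `x`
-- itself. The strand `x` divides the diagram between the two into a left and a right half; sliding
-- these away exposes the source of a rule `l`. The lowest winding number is treated in the mirror
-- image, with a rule `r`. So either an extreme winding number is not involved and the interval
-- shrinks, or a step starts from the cell: `reducible_of_top`, `reducible_of_bot`,
-- `unitOrCounit_eq_zero_or_reducible`. A cell without units and counits whose source is some `f^0`
-- is some `α^0` (`exists_zeroTotal_eq`), and a step removes one unit and one counit, so rewriting
-- terminates. This gives the first claim, surjectivity in the second, and fullness.
--
-- Faithfulness. The argument is semantic; confluence is not used. An equality in the presented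
-- 2-category needs finitely many rules, so it holds in the 2-category `C_N` presented by the rules
-- with winding number in `(-N, N]`. It remains to show by induction on `N` that `E^* → C_N` is
-- faithful. For a 0-cell `X`, the 2-category `C_N` acts by precomposition on the categories of
-- functors from `C_N(A, X)` to types, and by Yoneda this detects equality of 2-cells with target
-- `X` (`starMap_injective`). The rules make `f^(n-1)` left adjoint to `f^n` in `C_N`, hence also in
-- this action. The adjoints missing at the two ends, for `f^(N+1)` and `f^(-N-1)`, are right and
-- left Kan extensions (`nonempty_kanFunctor_adjunction`). All rules of `C_(N+1)` therefore hold in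
-- an action in which `α^0` still acts as it does in `C_N`, so an equality `α^0 = β^0` descends from
-- `C_(N+1)` to `C_N` (`Model.cell_eq`). In `C_0` there are no rules, and the action of `E^*` on its
-- own presheaves recovers `α = β`.

universe m n

/-! ### Calculus of 2-cells bundled with their boundary, and the sliding lemmas -/

namespace PathTwoCat

section

variable {V : Type u} [Quiver.{v} V]

/-- A 2-cell together with its boundary. -/
structure Total (C : PathTwoCat.{w} V) (a b : V) where
  src : Path a b
  tgt : Path a b
  cell : C.Cell src tgt

variable {C : PathTwoCat.{w} V}

namespace Total

theorem mk_eq_of_heq {a b : V} {f g f' g' : Path a b} (hf : f = f') (hg : g = g')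
    {α : C.Cell f g} {β : C.Cell f' g'} (h : α ≍ β) :
    (⟨f, g, α⟩ : C.Total a b) = ⟨f', g', β⟩ := by
  subst hf hg
  rw [eq_of_heq h]

theorem heq_of_mk_eq {a b : V} {f g f' g' : Path a b} {α : C.Cell f g} {β : C.Cell f' g'}
    (h : (⟨f, g, α⟩ : C.Total a b) = ⟨f', g', β⟩) : α ≍ β := by
  cases h; rfl

theorem mk_castCell {a b : V} {f g f' g' : Path a b} (hf : f = f') (hg : g = g')
    (α : C.Cell f g) :
    (⟨f', g', C.castCell hf hg α⟩ : C.Total a b) = ⟨f, g, α⟩ :=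
  mk_eq_of_heq hf.symm hg.symm (C.castCell_heq hf hg α)

variable (C) in
/-- The identity 2-cell of a path. -/
def one {a b : V} (p : Path a b) : C.Total a b := ⟨p, p, C.id p⟩

/-- Horizontal composition. -/
def hc {a b c : V} (A : C.Total a b) (B : C.Total b c) : C.Total a c :=
  ⟨A.src.comp B.src, A.tgt.comp B.tgt, C.hcomp A.cell B.cell⟩

open Classical in
/-- Vertical composition, meaningful for composable 2-cells only. -/
noncomputable def vc {a b : V} (A B : C.Total a b) : C.Total a b :=
  -- The junk value `A` makes `vc_src` hold without a composability hypothesis; `vc_tgt` needs one.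
  if h : B.src = A.tgt then ⟨A.src, B.tgt, C.vcomp A.cell (C.castCell h rfl B.cell)⟩ else A

local infixr:70 " ⊠ " => hc
local infixr:65 " ⬝ " => vc

@[simp] theorem one_src {a b : V} (p : Path a b) : (one C p).src = p := rfl
@[simp] theorem one_tgt {a b : V} (p : Path a b) : (one C p).tgt = p := rfl
@[simp] theorem hc_src {a b c : V} (A : C.Total a b) (B : C.Total b c) :
    (A ⊠ B).src = A.src.comp B.src := rfl
@[simp] theorem hc_tgt {a b c : V} (A : C.Total a b) (B : C.Total b c) :
    (A ⊠ B).tgt = A.tgt.comp B.tgt := rfl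

theorem mk_vc_mk {a b : V} {f g h : Path a b} (α : C.Cell f g) (β : C.Cell g h) :
    (⟨f, g, α⟩ ⬝ ⟨g, h, β⟩ : C.Total a b) = ⟨f, h, C.vcomp α β⟩ := by
  rw [vc, dif_pos rfl]; rfl

@[simp] theorem vc_src {a b : V} (A B : C.Total a b) : (A ⬝ B).src = A.src := by
  rw [vc]; split <;> rfl

@[simp] theorem vc_tgt {a b : V} {A B : C.Total a b} (h : A.tgt = B.src) :
    (A ⬝ B).tgt = B.tgt := by
  rw [vc, dif_pos h.symm]

theorem vc_assoc {a b : V} {A B D : C.Total a b} (h : A.tgt = B.src) (h' : B.tgt = D.src) :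
    (A ⬝ B) ⬝ D = A ⬝ B ⬝ D := by
  obtain ⟨f, g, α⟩ := A; obtain ⟨g', k, β⟩ := B; obtain ⟨k', l, γ⟩ := D
  obtain rfl : g = g' := h
  obtain rfl : k = k' := h'
  simp only [mk_vc_mk, C.vcomp_assoc]

theorem one_vc {a b : V} {p : Path a b} {A : C.Total a b} (h : p = A.src) :
    one C p ⬝ A = A := by
  subst h
  exact (mk_vc_mk _ _).trans (congrArg _ (C.id_vcomp _))

theorem vc_one {a b : V} {p : Path a b} {A : C.Total a b} (h : A.tgt = p) :
    A ⬝ one C p = A := by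
  subst h
  exact (mk_vc_mk _ _).trans (congrArg _ (C.vcomp_id _))

theorem interchange {a b c : V} {A A' : C.Total a b} {B B' : C.Total b c}
    (h : A.tgt = A'.src) (h' : B.tgt = B'.src) :
    (A ⬝ A') ⊠ (B ⬝ B') = (A ⊠ B) ⬝ (A' ⊠ B') := by
  obtain ⟨f, g, α⟩ := A; obtain ⟨g', k, β⟩ := A'
  obtain ⟨f₁, g₁, α₁⟩ := B; obtain ⟨g₁', k₁, β₁⟩ := B'
  obtain rfl : g = g' := h
  obtain rfl : g₁ = g₁' := h'
  rw [mk_vc_mk, mk_vc_mk]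
  refine Eq.trans (congrArg (Total.mk _ _) (C.interchange α β α₁ β₁)) ?_
  exact (mk_vc_mk (C.hcomp α α₁) (C.hcomp β β₁)).symm

theorem hc_assoc {a b c d : V} (A : C.Total a b) (B : C.Total b c) (D : C.Total c d) :
    (A ⊠ B) ⊠ D = A ⊠ B ⊠ D :=
  mk_eq_of_heq (Path.comp_assoc _ _ _) (Path.comp_assoc _ _ _) (C.hcomp_assoc _ _ _)

theorem one_nil_hc {a b : V} (A : C.Total a b) : one C (Path.nil : Path a a) ⊠ A = A :=
  mk_eq_of_heq (Path.nil_comp _) (Path.nil_comp _) (C.id_hcomp _)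

theorem hc_one_nil {a b : V} (A : C.Total a b) : A ⊠ one C (Path.nil : Path b b) = A :=
  mk_eq_of_heq (Path.comp_nil _) (Path.comp_nil _) (C.hcomp_id _)

theorem one_hc_one {a b c : V} (p : Path a b) (q : Path b c) :
    one C p ⊠ one C q = one C (p.comp q) :=
  congrArg (Total.mk _ _) (C.hcomp_ids p q)

theorem one_comp_hc {a b c d : V} (p : Path a b) (q : Path b c) (A : C.Total c d) :
    one C (p.comp q) ⊠ A = one C p ⊠ one C q ⊠ A := by
  rw [← one_hc_one, hc_assoc]

theorem hc_split_left {a b c : V} {A : C.Total a b} {B B' : C.Total b c} {p : Path a b}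
    (h : A.tgt = p) (h' : B.tgt = B'.src) : A ⊠ (B ⬝ B') = (A ⊠ B) ⬝ (one C p ⊠ B') := by
  rw [← interchange h h', vc_one h]

theorem hc_split_right {a b c : V} {A A' : C.Total a b} {B : C.Total b c} {p : Path b c}
    (h : A.tgt = A'.src) (h' : B.tgt = p) : (A ⬝ A') ⊠ B = (A ⊠ B) ⬝ (A' ⊠ one C p) := by
  rw [← interchange h h', vc_one h']

theorem hc_split_right' {a b c : V} {A A' : C.Total a b} {B : C.Total b c} {p : Path b c}
    (h : A.tgt = A'.src) (h' : p = B.src) : (A ⬝ A') ⊠ B = (A ⊠ one C p) ⬝ (A' ⊠ B) := by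
  rw [← interchange h h', one_vc h']

/-- The strand `x` created by `η` and destroyed by `ε` keeps `X` on its left and `Y` on its right.
`X` consumes the leg `y` of `η` and `Y` produces the leg `y` of `ε`, so `Y` can be moved before `η`
and `X` after `ε`, which leaves the bare zigzag on `y`. -/
theorem zigzag_left {a b c d : V} {u : Path a c} {y : Path c d} {x : Path d c} {v : Path c b}
    {u₁ : Path a d} {v₁ : Path d b} {η : C.Total c c} {ε : C.Total d d} {X : C.Total a d}
    {Y : C.Total c b} (hη : η.src = Path.nil) (hη' : η.tgt = y.comp x)
    (hε : ε.src = x.comp y) (hε' : ε.tgt = Path.nil) (hX : X.src = u.comp y) (hX' : X.tgt = u₁)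
    (hY : Y.src = v) (hY' : Y.tgt = y.comp v₁) :
    (one C u ⊠ η ⊠ one C v) ⬝ (X ⊠ one C x ⊠ Y) ⬝ (one C u₁ ⊠ ε ⊠ one C v₁) =
      (one C u ⊠ Y) ⬝ (one C u ⊠ ((η ⊠ one C y) ⬝ (one C y ⊠ ε)) ⊠ one C v₁) ⬝
        (X ⊠ one C v₁) := by
  -- The middle layer is split by interchange with `Y` first; then `h₂` moves `Y` above `η` and `h₃`
  -- moves `X` below `ε`.
  have h₁ : X ⊠ one C x ⊠ Y =
      (one C u ⊠ one C y ⊠ one C x ⊠ Y) ⬝ (X ⊠ one C x ⊠ one C y ⊠ one C v₁) := by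
    rw [one_hc_one y v₁, ← one_comp_hc u y, ← interchange (by simp [hX]) (by simp [hY']),
      ← interchange rfl (by simp [hY']), one_vc hX.symm, vc_one (p := x) rfl, vc_one hY']
  have h₂ : (one C u ⊠ η ⊠ one C v) ⬝ (one C u ⊠ one C y ⊠ one C x ⊠ Y) =
      (one C u ⊠ Y) ⬝ (one C u ⊠ η ⊠ one C y ⊠ one C v₁) := by
    rw [← one_comp_hc y x, ← hc_split_left (p := u) rfl (by simp [hη', hY]),
      ← interchange (by simp [hη']) (by simp [hY]), vc_one hη', one_vc hY.symm, one_hc_one y v₁,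
      ← hc_split_left (p := u) rfl (by simp [hη, hY'])]
    conv_rhs => rw [← one_nil_hc Y, ← interchange (by simp [hη]) (by simp [hY']),
      one_vc hη.symm, vc_one hY']
  have h₃ : (X ⊠ one C x ⊠ one C y ⊠ one C v₁) ⬝ (one C u₁ ⊠ ε ⊠ one C v₁) =
      (one C u ⊠ one C y ⊠ ε ⊠ one C v₁) ⬝ (X ⊠ one C v₁) := by
    rw [← one_comp_hc x y, ← interchange (by simp [hX']) (by simp [hε]),
      ← interchange (by simp [hε]) rfl, vc_one hX', one_vc hε.symm, vc_one (p := v₁) rfl,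
      ← one_comp_hc u y]
    conv_rhs => arg 2; rw [← one_nil_hc (one C v₁)]
    rw [← interchange (by simp [hX]) (by simp [hε']), one_vc hX.symm,
      ← interchange (by simp [hε']) (by simp), vc_one hε', vc_one (p := v₁) rfl]
  have h₄ : one C u ⊠ ((η ⊠ one C y) ⬝ (one C y ⊠ ε)) ⊠ one C v₁ =
      (one C u ⊠ η ⊠ one C y ⊠ one C v₁) ⬝ (one C u ⊠ one C y ⊠ ε ⊠ one C v₁) := by
    rw [hc_split_right (p := v₁) (by simp [hη', hε]) rfl,
      hc_split_left (p := u) rfl (by simp [hη', hε]), hc_assoc, hc_assoc]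
  rw [h₁, h₄, vc_assoc, h₃, ← vc_assoc, h₂, vc_assoc, vc_assoc] <;>
    simp [hη, hη', hε, hε', hX, hX', hY, hY']

/-- Mirror image of `zigzag_left`: the separating strand is now `y`, and `X` is the half that is
moved before `η`. -/
theorem zigzag_right {a b c d : V} {u : Path a c} {y : Path c d} {x : Path d c} {v : Path c b}
    {u₁ : Path a d} {v₁ : Path d b} {η : C.Total c c} {ε : C.Total d d} {X : C.Total a c}
    {Y : C.Total d b} (hη : η.src = Path.nil) (hη' : η.tgt = y.comp x)
    (hε : ε.src = x.comp y) (hε' : ε.tgt = Path.nil) (hX : X.src = u) (hX' : X.tgt = u₁.comp x)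
    (hY : Y.src = x.comp v) (hY' : Y.tgt = v₁) :
    (one C u ⊠ η ⊠ one C v) ⬝ (X ⊠ one C y ⊠ Y) ⬝ (one C u₁ ⊠ ε ⊠ one C v₁) =
      (X ⊠ one C v) ⬝ (one C u₁ ⊠ ((one C x ⊠ η) ⬝ (ε ⊠ one C x)) ⊠ one C v) ⬝
        (one C u₁ ⊠ Y) := by
  have h₁ : X ⊠ one C y ⊠ Y =
      (X ⊠ one C y ⊠ one C x ⊠ one C v) ⬝ (one C u₁ ⊠ one C x ⊠ one C y ⊠ Y) := by
    rw [one_hc_one x v, ← one_comp_hc u₁ x, ← interchange (by simp [hX']) (by simp [hY]),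
      ← interchange rfl (by simp [hY]), vc_one hX', vc_one (p := y) rfl, one_vc hY.symm]
  have h₂ : (one C u ⊠ η ⊠ one C v) ⬝ (X ⊠ one C y ⊠ one C x ⊠ one C v) =
      (X ⊠ one C v) ⬝ (one C u₁ ⊠ one C x ⊠ η ⊠ one C v) := by
    rw [← one_comp_hc y x, ← interchange (by simp [hX]) (by simp [hη']),
      ← interchange (by simp [hη']) rfl, one_vc hX.symm, vc_one hη', vc_one (p := v) rfl,
      ← one_comp_hc u₁ x]
    conv_rhs => arg 1; rw [← one_nil_hc (one C v)]
    rw [← interchange (by simp [hX']) (by simp [hη]), vc_one hX',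
      ← interchange (by simp [hη]) (by simp), one_vc hη.symm, vc_one (p := v) rfl]
  have h₃ : (one C u₁ ⊠ one C x ⊠ one C y ⊠ Y) ⬝ (one C u₁ ⊠ ε ⊠ one C v₁) =
      (one C u₁ ⊠ ε ⊠ one C x ⊠ one C v) ⬝ (one C u₁ ⊠ Y) := by
    rw [← one_comp_hc x y, ← hc_split_left (p := u₁) rfl (by simp [hε, hY']),
      ← interchange (by simp [hε]) (by simp [hY']), one_vc hε.symm, vc_one hY', one_hc_one x v,
      ← hc_split_left (p := u₁) rfl (by simp [hε', hY])]
    conv_rhs => rw [← one_nil_hc Y, ← interchange (by simp [hε']) (by simp [hY]),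
      vc_one hε', one_vc hY.symm]
  have h₄ : one C u₁ ⊠ ((one C x ⊠ η) ⬝ (ε ⊠ one C x)) ⊠ one C v =
      (one C u₁ ⊠ one C x ⊠ η ⊠ one C v) ⬝ (one C u₁ ⊠ ε ⊠ one C x ⊠ one C v) := by
    rw [hc_split_right (p := v) (by simp [hη', hε]) rfl,
      hc_split_left (p := u₁) rfl (by simp [hη', hε]), hc_assoc, hc_assoc]
  rw [h₁, h₄, vc_assoc, h₃, ← vc_assoc, h₂, vc_assoc, vc_assoc] <;>
    simp [hη, hη', hε, hε', hX, hX', hY, hY']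

end Total

end

end PathTwoCat

/-! ### Weights of bundled cells, and following one letter through a 2-cell -/

namespace TwoPolygraph

open PathTwoCat

section

variable {V : Type u} [Quiver.{v} V] {E : TwoPolygraph.{w} V}

/-- The 2-cell of a formal composite, with its boundary. -/
def Term.total {a b : V} {f g : Path a b} (t : E.Term f g) : E.free.Total a b :=
  ⟨f, g, Quot.mk _ t⟩

/-- The 2-cell of a 2-generator, with its boundary. -/
def genTotal {a b : V} {f g : Path a b} (α : E.Gen f g) : E.free.Total a b := ⟨f, g, E.of α⟩

theorem Term.total_vcomp {a b : V} {f g h : Path a b} (s : E.Term f g) (t : E.Term g h) :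
    (s.vcomp t).total = s.total.vc t.total := by
  exact (Total.mk_vc_mk (C := E.free) (Quot.mk _ s) (Quot.mk _ t)).symm

theorem Term.total_hcomp {a b c : V} {f f' : Path a b} {g g' : Path b c} (s : E.Term f f')
    (t : E.Term g g') : (s.hcomp t).total = s.total.hc t.total := rfl

/-- The weight of a 2-cell with boundary. -/
def tweight (φ : ∀ {a b : V} {f g : Path a b}, E.Gen f g → ℕ) {a b : V}
    (A : E.free.Total a b) : ℕ := weight φ A.cell

section

variable (φ : ∀ {a b : V} {f g : Path a b}, E.Gen f g → ℕ)

theorem tweight_hc {a b c : V} (A : E.free.Total a b) (B : E.free.Total b c) :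
    tweight φ (A.hc B) = tweight φ A + tweight φ B :=
  weight_hcomp φ A.cell B.cell

theorem tweight_vc {a b : V} {A B : E.free.Total a b} (h : A.tgt = B.src) :
    tweight φ (A.vc B) = tweight φ A + tweight φ B := by
  obtain ⟨f, g, α⟩ := A; obtain ⟨g', k, β⟩ := B
  obtain rfl : g = g' := h
  rw [Total.mk_vc_mk]
  exact weight_vcomp φ α β

/-- Weights are additive for both compositions, so a bound on generators passes to all cells. Two
weights on the right cover every comparison made later; where one would do, it is taken twice. -/
theorem tweight_le_add (ψ χ : ∀ {a b : V} {f g : Path a b}, E.Gen f g → ℕ)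
    (h : ∀ {a b : V} {f g : Path a b} (α : E.Gen f g), φ α ≤ ψ α + χ α) {a b : V}
    (A : E.free.Total a b) : tweight φ A ≤ tweight ψ A + tweight χ A := by
  obtain ⟨f, g, ⟨t⟩⟩ := A
  change tweight φ t.total ≤ tweight ψ t.total + tweight χ t.total
  clear * -h
  induction t with
  | gen α => exact h α
  | id f => exact Nat.zero_le _
  | vcomp s t hs ht =>
    rw [Term.total_vcomp, tweight_vc _ rfl, tweight_vc _ rfl, tweight_vc _ rfl]
    exact (Nat.add_le_add hs ht).trans_eq (Nat.add_add_add_comm _ _ _ _)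
  | hcomp s t hs ht =>
    rw [Term.total_hcomp, tweight_hc, tweight_hc, tweight_hc]
    exact (Nat.add_le_add hs ht).trans_eq (Nat.add_add_add_comm _ _ _ _)

end

/-- The marked letter lies in one of the two factors; this decides which half of a horizontal
composite it is followed through. -/
theorem _root_.Quiver.Path.comp_eq_comp_toPath_comp {a b c d e : V} {p : Path a b}
    {p' : Path b c} {u : Path a d} {x : d ⟶ e} {v : Path e c}
    (h : p.comp p' = u.comp (x.toPath.comp v)) :
    (∃ w, p = u.comp (x.toPath.comp w) ∧ v = w.comp p') ∨
      ∃ w, p' = w.comp (x.toPath.comp v) ∧ u = p.comp w := by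
  induction v with
  | nil =>
    cases p' with
    | nil => exact .inl ⟨Path.nil, h, rfl⟩
    | cons p'' y =>
      obtain rfl := Path.obj_eq_of_cons_eq_cons h
      obtain rfl := eq_of_heq (Path.heq_of_cons_eq_cons h)
      obtain rfl := eq_of_heq (Path.hom_heq_of_cons_eq_cons h)
      exact .inr ⟨p'', rfl, rfl⟩
  | cons v' y ih =>
    cases p' with
    | nil => exact .inl ⟨v'.cons y, h, rfl⟩
    | cons p'' z =>
      obtain rfl := Path.obj_eq_of_cons_eq_cons h
      obtain rfl := eq_of_heq (Path.hom_heq_of_cons_eq_cons h)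
      rcases ih (eq_of_heq (Path.heq_of_cons_eq_cons h)) with ⟨w, rfl, rfl⟩ | ⟨w, rfl, rfl⟩
      · exact .inl ⟨w, rfl, rfl⟩
      · exact .inr ⟨w, rfl, rfl⟩

local infixr:70 " ⊠ " => Total.hc
local infixr:65 " ⬝ " => Total.vc

open Total in
/-- Either the letter `x` of the source survives, or it is consumed by a 2-generator. -/
theorem Term.follow {a b : V} {p q : Path a b} (t : E.Term p q) : ∀ {c d : V} (u : Path a c)
    (x : c ⟶ d) (v : Path d b), p = u.comp (x.toPath.comp v) →
    (∃ (X : E.free.Total a c) (Y : E.free.Total d b), X.src = u ∧ Y.src = v ∧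
      t.total = X.hc ((Total.one _ x.toPath).hc Y)) ∨
    ∃ (e e' : V) (f g : Path e e') (α : E.Gen f g) (s₁ : Path e c) (s₂ : Path d e')
      (u₁ : Path a e) (v₁ : Path e' b) (X : E.free.Total a c) (Y : E.free.Total d b)
      (R : E.free.Total a b), f = s₁.comp (x.toPath.comp s₂) ∧ X.src = u ∧ Y.src = v ∧
      X.tgt = u₁.comp s₁ ∧ Y.tgt = s₂.comp v₁ ∧ R.src = u₁.comp (g.comp v₁) ∧
      t.total = (X.hc ((Total.one _ x.toPath).hc Y)).vc
        (((Total.one _ u₁).hc ((genTotal α).hc (Total.one _ v₁))).vc R) := by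
  induction t with
  | @gen a b f g α =>
    -- A generator consumes every letter of its source at once, so the surroundings `u₁`, `v₁` are
    -- empty and `X`, `Y`, `R` are identities.
    rintro c d u x v rfl
    refine .inr ⟨_, _, _, _, α, u, v, Path.nil, Path.nil, one _ u, one _ v, one _ _, rfl, rfl,
      rfl, (Path.nil_comp _).symm, rfl, (Path.nil_comp _).symm, ?_⟩
    rw [one_hc_one, one_hc_one, one_nil_hc, hc_one_nil, vc_one (p := g) rfl]
    exact (one_vc (A := genTotal α) rfl).symm
  | id f =>
    rintro c d u x v rfl
    refine .inl ⟨one _ u, one _ v, rfl, rfl, ?_⟩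
    rw [one_hc_one, one_hc_one]
    rfl
  | @vcomp a b f g h s t hs ht =>
    intro c d u x v hp
    rw [total_vcomp]
    rcases hs u x v hp with ⟨X, Y, rfl, rfl, hst⟩ |
      ⟨e, e', f, g, α, s₁, s₂, u₁, v₁, X, Y, R, hf, rfl, rfl, hX, hY, hR, hst⟩
    -- The letter survives `s`, sits between the targets of `X` and `Y`, and is followed further
    -- through `t`.
    · have hg : g = X.tgt.comp (x.toPath.comp Y.tgt) := congrArg Total.tgt hst
      rcases ht _ _ _ hg with ⟨X', Y', hX', hY', hst'⟩ |
        ⟨e, e', f, g, α, s₁, s₂, u₁, v₁, X', Y', R, hf, hX', hY', hX, hY, hR, hst'⟩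
      · refine .inl ⟨X ⬝ X', Y ⬝ Y', by simp, by simp, ?_⟩
        rw [hst, hst', ← interchange hX'.symm (by simp [hY']), ← interchange rfl hY'.symm,
          vc_one (p := x.toPath) rfl]
      · refine .inr ⟨e, e', f, g, α, s₁, s₂, u₁, v₁, X ⬝ X', Y ⬝ Y', R, hf, by simp, by simp,
          by rw [vc_tgt hX'.symm, hX], by rw [vc_tgt hY'.symm, hY], hR, ?_⟩
        rw [hst, hst', ← vc_assoc (by simp [hX', hY']) (by
          simp [hX, hY, hf, genTotal]), ← interchange hX'.symm (by simp [hY']),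
          ← interchange rfl hY'.symm, vc_one (p := x.toPath) rfl]
    · have hg : R.tgt = t.total.src := by
        have := congrArg Total.tgt hst
        rw [vc_tgt, vc_tgt] at this
        · exact this.symm
        · simp [hR, genTotal]
        · simp [hX, hY, hf, genTotal]
      refine .inr ⟨e, e', f, g, α, s₁, s₂, u₁, v₁, X, Y, R ⬝ t.total, hf, rfl, rfl, hX, hY,
        by simp [hR], ?_⟩
      rw [hst, vc_assoc, vc_assoc _ hg]
      · simp [hR, genTotal]
      · simp [hX, hY, hf, genTotal]
      · rwa [vc_tgt]
        simp [hR, genTotal]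
  | @hcomp a b c f f' g g' s t hs ht =>
    intro _ _ u x v hp
    rw [total_hcomp]
    rcases Path.comp_eq_comp_toPath_comp hp with ⟨w, hw, rfl⟩ | ⟨w, hw, rfl⟩
    · rcases hs _ _ _ hw with ⟨X, Y, rfl, rfl, hst⟩ |
        ⟨e, e', f, g, α, s₁, s₂, u₁, v₁, X, Y, R, hf, rfl, rfl, hX, hY, hR, hst⟩
      · exact .inl ⟨X, Y ⊠ t.total, rfl, rfl, by rw [hst, hc_assoc, hc_assoc]⟩
      · refine .inr ⟨e, e', f, g, α, s₁, s₂, u₁, v₁.comp g', X, Y ⊠ t.total, R ⊠ one _ g', hf,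
          rfl, rfl, hX, by simp [hY, Term.total], by simp [hR], ?_⟩
        rw [hst, hc_split_right (p := g') _ rfl, hc_split_right (p := g') _ rfl,
          ← one_hc_one v₁]
        · simp only [hc_assoc]
        · simp [hR, genTotal]
        · simp [hX, hY, hf, genTotal]
    · rcases ht _ _ _ hw with ⟨X, Y, rfl, rfl, hst⟩ |
        ⟨e, e', f, g, α, s₁, s₂, u₁, v₁, X, Y, R, hf, rfl, rfl, hX, hY, hR, hst⟩
      · exact .inl ⟨s.total ⊠ X, Y, rfl, rfl, by rw [hst, hc_assoc]⟩
      · refine .inr ⟨e, e', f, g, α, s₁, s₂, f'.comp u₁, v₁, s.total ⊠ X, Y, one _ f' ⊠ R, hf,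
          rfl, rfl, by simp [hX, Term.total], hY, by simp [hR], ?_⟩
        rw [hst, hc_split_left (p := f') rfl, hc_split_left (p := f') rfl,
          ← one_hc_one f' u₁]
        · simp only [hc_assoc]
        · simp [hR, genTotal]
        · simp [hX, hY, hf, genTotal]

open Total in
theorem follow {a b c d : V} (A : E.free.Total a b) (u : Path a c) (x : c ⟶ d) (v : Path d b)
    (hA : A.src = u.comp (x.toPath.comp v)) :
    (∃ (X : E.free.Total a c) (Y : E.free.Total d b), X.src = u ∧ Y.src = v ∧
      A = X ⊠ one _ x.toPath ⊠ Y) ∨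
    ∃ (e e' : V) (f g : Path e e') (α : E.Gen f g) (s₁ : Path e c) (s₂ : Path d e')
      (u₁ : Path a e) (v₁ : Path e' b) (X : E.free.Total a c) (Y : E.free.Total d b)
      (R : E.free.Total a b), f = s₁.comp (x.toPath.comp s₂) ∧ X.src = u ∧ Y.src = v ∧
      X.tgt = u₁.comp s₁ ∧ Y.tgt = s₂.comp v₁ ∧ R.src = u₁.comp (g.comp v₁) ∧
      A = (X ⊠ one _ x.toPath ⊠ Y) ⬝ (one _ u₁ ⊠ genTotal α ⊠ one _ v₁) ⬝ R := by
  obtain ⟨f, g, ⟨t⟩⟩ := A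
  exact t.follow u x v hA

end

end TwoPolygraph

/-! ### Winding numbers, and redexes at an extreme winding number -/

namespace FormalAdj

open PathTwoCat PathTwoCat.Total TwoPolygraph

section

variable {V : Type u} [Quiver.{v} V]

local infixr:70 " ⊠ " => Total.hc
local infixr:65 " ⬝ " => Total.vc

/-- The winding number of a 1-generator. -/
def wind {A B : FormalAdj V} : (A ⟶ B) → ℤ
  | .even _ n _ => n
  | .odd _ n _ => n

@[simp] theorem wind_pred {A B : FormalAdj V} : ∀ x : A ⟶ B, wind (pred x) = wind x - 1
  | .even _ _ _ => rfl
  | .odd _ _ _ => rfl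

@[simp] theorem wind_zero {A B : V} (f : A ⟶ B) : wind ((zero V).map f) = 0 := rfl

theorem pred_injective {A B : FormalAdj V} : ∀ {x y : A ⟶ B}, pred x = pred y → x = y
  | .even f m hm, .even g n hn, h => by
    injection h with _ _ h₁ h₂
    subst h₁
    obtain rfl : m = n := by omega
    rfl
  | .odd f m hm, .odd g n hn, h => by
    injection h with _ _ h₁ h₂
    subst h₁
    obtain rfl : m = n := by omega
    rfl
  | .even .., .odd .., h => by injection h
  | .odd .., .even .., h => by injection h

/-- The path has no letter of winding number `n`. -/
def NoWind (n : ℤ) {A : FormalAdj V} : ∀ {B : FormalAdj V}, Path A B → Prop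
  | _, .nil => True
  | _, .cons p x => NoWind n p ∧ wind x ≠ n

@[simp] theorem noWind_nil (n : ℤ) (A : FormalAdj V) : NoWind n (Path.nil : Path A A) := trivial

@[simp] theorem noWind_cons {n : ℤ} {A B C : FormalAdj V} {p : Path A B} {x : B ⟶ C} :
    NoWind n (p.cons x) ↔ NoWind n p ∧ wind x ≠ n := Iff.rfl

@[simp] theorem noWind_toPath {n : ℤ} {A B : FormalAdj V} {x : A ⟶ B} :
    NoWind n x.toPath ↔ wind x ≠ n := by
  simp [Hom.toPath, NoWind]

@[simp] theorem noWind_comp {n : ℤ} {A B C : FormalAdj V} {p : Path A B} {q : Path B C} :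
    NoWind n (p.comp q) ↔ NoWind n p ∧ NoWind n q := by
  induction q with
  | nil => exact (and_iff_left trivial).symm
  | cons q x ih => rw [Path.comp_cons, NoWind, NoWind, ih, and_assoc]

/-- This is how the boundary condition enters: neither the boundary of the cell nor the boundary of
any `α^0` contains a letter of nonzero winding number. -/
theorem noWind_mapPath_zero {n : ℤ} (hn : n ≠ 0) {A B : V} (f : Path A B) :
    NoWind n ((zero V).mapPath f) := by
  induction f with
  | nil => trivial
  | cons f x ih => exact ⟨ih, hn.symm⟩

variable {E : TwoPolygraph.{w} V}

/-- The unit `η_x`, with its boundary. -/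
def unitTotal (E : TwoPolygraph.{w} V) {A B : FormalAdj V} (x : A ⟶ B) :
    (polygraph E).free.Total B B := genTotal (Gen₂.unit x)

/-- The counit `ε_x`, with its boundary. -/
def counitTotal (E : TwoPolygraph.{w} V) {A B : FormalAdj V} (x : A ⟶ B) :
    (polygraph E).free.Total A A := genTotal (Gen₂.counit x)

/-- Some rewriting step starts from the 2-cell. -/
def Reducible {A B : FormalAdj V} (X : (polygraph E).free.Total A B) : Prop :=
  ∃ β, (polygraph E).Step X.cell β

theorem Reducible.hc_left {A B C : FormalAdj V} {X : (polygraph E).free.Total B C}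
    (h : Reducible X) (Y : (polygraph E).free.Total A B) : Reducible (Y ⊠ X) :=
  ⟨_, h.choose_spec.hcomp_left Y.cell⟩

theorem Reducible.hc_right {A B C : FormalAdj V} {X : (polygraph E).free.Total A B}
    (h : Reducible X) (Y : (polygraph E).free.Total B C) : Reducible (X ⊠ Y) :=
  ⟨_, h.choose_spec.hcomp_right Y.cell⟩

theorem Reducible.vc_left {A B : FormalAdj V} {X : (polygraph E).free.Total A B}
    (h : Reducible X) (Y : (polygraph E).free.Total A B) (e : Y.tgt = X.src) :
    Reducible (Y ⬝ X) := by
  obtain ⟨f, g, α⟩ := X; obtain ⟨f', g', β⟩ := Y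
  obtain rfl : g' = f := e
  rw [mk_vc_mk]
  exact ⟨_, h.choose_spec.vcomp_left β⟩

theorem Reducible.vc_right {A B : FormalAdj V} {X : (polygraph E).free.Total A B}
    (h : Reducible X) (Y : (polygraph E).free.Total A B) (e : X.tgt = Y.src) :
    Reducible (X ⬝ Y) := by
  obtain ⟨f, g, α⟩ := X; obtain ⟨f', g', β⟩ := Y
  obtain rfl : g = f' := e
  rw [mk_vc_mk]
  exact ⟨_, h.choose_spec.vcomp_right β⟩

theorem reducible_of_gen₃ {A B : FormalAdj V} {f g : Path A B}
    {α β : (polygraph E).free.Cell f g} (r : Gen₃ E α β) :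
    Reducible (⟨f, g, α⟩ : (polygraph E).free.Total A B) :=
  ⟨_, .mk (F := polygraph E) r ⟨TwoPolygraph.of _ .var, rfl⟩⟩

theorem reducible_left {A B : FormalAdj V} (x : A ⟶ B) :
    Reducible ((unitTotal E x ⊠ one _ (pred x).toPath) ⬝
      (one _ (pred x).toPath ⊠ counitTotal E x)) :=
  (mk_vc_mk (C := (polygraph E).free) (f := (pred x).toPath) (h := (pred x).toPath)
    ((twoPolygraph E).free.hcomp (η E x) ((twoPolygraph E).free.id (pred x).toPath))
    ((twoPolygraph E).free.hcomp ((twoPolygraph E).free.id (pred x).toPath) (ε E x))).symm ▸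
    reducible_of_gen₃ (Gen₃.l x)

theorem reducible_right {A B : FormalAdj V} (x : A ⟶ B) :
    Reducible ((one _ x.toPath ⊠ unitTotal E x) ⬝ (counitTotal E x ⊠ one _ x.toPath)) :=
  (mk_vc_mk (C := (polygraph E).free) (f := x.toPath) (h := x.toPath)
    ((twoPolygraph E).free.hcomp ((twoPolygraph E).free.id x.toPath) (η E x))
    ((twoPolygraph E).free.hcomp (ε E x) ((twoPolygraph E).free.id x.toPath))).symm ▸
    reducible_of_gen₃ (Gen₃.r x)

/-- The indicator function of the units and counits which involve winding number `n`. -/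
def touches (n : ℤ) {A B : FormalAdj V} {f g : Path A B} : (polygraph E).Gen f g → ℕ
  | Gen₂.base _ => 0
  | Gen₂.unit x => if wind x = n ∨ wind (pred x) = n then 1 else 0
  | Gen₂.counit x => if wind x = n ∨ wind (pred x) = n then 1 else 0

/-- The indicator function of the units and counits which involve a winding number outside of
the interval `[-m, n]`. -/
def outside (m n : ℕ) {A B : FormalAdj V} {f g : Path A B} : (polygraph E).Gen f g → ℕ
  | Gen₂.base _ => 0
  | Gen₂.unit x => if -(m : ℤ) < wind x ∧ wind x ≤ n then 0 else 1
  | Gen₂.counit x => if -(m : ℤ) < wind x ∧ wind x ≤ n then 0 else 1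

/-- The winding number `n` does not appear unless it is created by a unit. -/
theorem exists_first_unit {n : ℤ} (hn : n ≠ 0) {A B : FormalAdj V} {p q : Path A B}
    (t : (polygraph E).Term p q) : NoWind n p →
    (tweight (touches n) t.total = 0 ∧ NoWind n q) ∨
    ∃ (C D : FormalAdj V) (x : C ⟶ D) (u : Path A D) (v : Path D B)
      (X Y : (polygraph E).free.Total A B), (wind x = n ∨ wind (pred x) = n) ∧
      X.tgt = u.comp v ∧ Y.src = u.comp (((pred x).toPath.comp x.toPath).comp v) ∧
      t.total = X ⬝ (one _ u ⊠ unitTotal E x ⊠ one _ v) ⬝ Y := by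
  induction t with
  | gen α =>
    intro hp
    cases α with
    | base α => exact .inl ⟨rfl, noWind_mapPath_zero hn _⟩
    | @unit A B x =>
      by_cases hx : wind x = n ∨ wind (pred x) = n
      · refine .inr ⟨_, _, x, Path.nil, Path.nil, one _ Path.nil,
          one _ ((pred x).toPath.comp x.toPath), hx, rfl, (Path.nil_comp _).symm, ?_⟩
        rw [one_nil_hc, hc_one_nil]
        exact ((one_vc (A := unitTotal E x ⬝ _) (by simp [unitTotal, genTotal])).trans
          (vc_one rfl)).symm
      · exact .inl ⟨if_neg hx, by simpa [not_or, and_comm] using hx⟩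
    | counit x =>
      -- A counit has both its letters in its source, where `n` does not occur.
      refine .inl ⟨if_neg ?_, trivial⟩
      simpa [not_or] using hp
  | id f => exact fun hp => .inl ⟨rfl, hp⟩
  | vcomp s t hs ht =>
    intro hp
    rw [Term.total_vcomp]
    rcases hs hp with ⟨hs, hp'⟩ | ⟨C, D, x, u, v, X, Y, hx, hX, hY, hst⟩
    · rcases ht hp' with ⟨ht, hp''⟩ | ⟨C, D, x, u, v, X, Y, hx, hX, hY, hst⟩
      · exact .inl ⟨by rw [tweight_vc _ rfl, hs, ht], hp''⟩
      · refine .inr ⟨C, D, x, u, v, s.total ⬝ X, Y, hx, ?_, hY, ?_⟩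
        · rw [vc_tgt, hX]
          have := congrArg Total.src hst
          rw [vc_src] at this
          exact this
        · rw [hst, vc_assoc]
          · have := congrArg Total.src hst
            rw [vc_src] at this
            exact this
          · rw [vc_src]
            exact hX.trans (by simp [unitTotal, genTotal])
    · have hXY : X.tgt = (one _ u ⊠ unitTotal E x ⊠ one _ v).src :=
        hX.trans (by simp [unitTotal, genTotal])
      have hXY' : (one _ u ⊠ unitTotal E x ⊠ one _ v).tgt = Y.src := hY.symm
      have hYt : Y.tgt = t.total.src := by
        have := congrArg Total.tgt hst
        rw [vc_tgt (by rwa [vc_src]), vc_tgt hXY'] at this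
        exact this.symm
      refine .inr ⟨C, D, x, u, v, X, Y ⬝ t.total, hx, hX, by rwa [vc_src], ?_⟩
      rw [hst, vc_assoc (by rwa [vc_src]) (by rwa [vc_tgt hXY']), vc_assoc hXY' hYt]
  | @hcomp _ _ _ f f' g g' s t hs ht =>
    intro hp
    rw [Term.total_hcomp]
    rw [noWind_comp] at hp
    rcases hs hp.1 with ⟨hs, hp'⟩ | ⟨C, D, x, u, v, X, Y, hx, hX, hY, hst⟩
    · rcases ht hp.2 with ⟨ht, hp''⟩ | ⟨C, D, x, u, v, X, Y, hx, hX, hY, hst⟩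
      · exact .inl ⟨by rw [tweight_hc, hs, ht], noWind_comp.2 ⟨hp', hp''⟩⟩
      · have hXY : X.tgt = (one _ u ⊠ unitTotal E x ⊠ one _ v).src :=
          hX.trans (by simp [unitTotal, genTotal])
        have hXY' : (one _ u ⊠ unitTotal E x ⊠ one _ v).tgt = Y.src := hY.symm
        refine .inr ⟨C, D, x, f'.comp u, v, s.total ⊠ X, one _ f' ⊠ Y, hx, ?_, ?_, ?_⟩
        · rw [hc_tgt, hX, Path.comp_assoc]; rfl
        · rw [hc_src, hY, Path.comp_assoc f']; rfl
        · rw [hst, hc_split_left (p := f') rfl (by rwa [vc_src]),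
            hc_split_left (p := f') rfl hXY', one_comp_hc]
    · have hXY : X.tgt = (one _ u ⊠ unitTotal E x ⊠ one _ v).src :=
        hX.trans (by simp [unitTotal, genTotal])
      have hXY' : (one _ u ⊠ unitTotal E x ⊠ one _ v).tgt = Y.src := hY.symm
      refine .inr ⟨C, D, x, u, v.comp g, X ⊠ one _ g, Y ⊠ t.total, hx, ?_, ?_, ?_⟩
      · rw [hc_tgt, hX, Path.comp_assoc]; rfl
      · rw [hc_src, hY]; simp [Term.total]
      · rw [hst, hc_split_right' (p := g) (by rwa [vc_src]) rfl,
          hc_split_right' (p := g) hXY' rfl, ← one_hc_one v]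
        simp only [hc_assoc]

/-- The only index gained by enlarging `(-m, n]` to `(-m, n + 1]` is `wind x = n + 1`, and then `x`
itself has the new winding number. -/
theorem outside_le_left (m n : ℕ) {A B : FormalAdj V} {f g : Path A B}
    (α : (polygraph E).Gen f g) :
    outside m n α ≤ outside m (n + 1) α + touches (n + 1) α := by
  cases α with
  | base => exact Nat.zero_le _
  | _ => simp only [outside, touches, wind_pred]; split_ifs <;> omega

/-- Here the index gained is `wind x = -m`, and it is the other letter, `pred x`, that has winding
number `-(m + 1)`. -/
theorem outside_le_right (m n : ℕ) {A B : FormalAdj V} {f g : Path A B}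
    (α : (polygraph E).Gen f g) :
    outside m n α ≤ outside (m + 1) n α + touches (-(m + 1)) α := by
  cases α with
  | base => exact Nat.zero_le _
  | _ => simp only [outside, touches, wind_pred]; split_ifs <;> omega

/-- The interval `(0, 0]` is empty, so `outside 0 0` counts all units and counits. -/
theorem outside_zero {A B : FormalAdj V} {f g : Path A B} (α : (polygraph E).Gen f g) :
    isUnitOrCounit α ≤ outside 0 0 α + outside 0 0 α := by
  cases α with
  | base => exact Nat.zero_le _
  | _ => simp only [outside, isUnitOrCounit]; split_ifs <;> omega

theorem outside_antitone {m n m' n' : ℕ} (hm : m ≤ m') (hn : n ≤ n') {A B : FormalAdj V}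
    {f g : Path A B} (α : (polygraph E).Gen f g) :
    outside m' n' α ≤ outside m n α + outside m n α := by
  cases α with
  | base => exact Nat.zero_le _
  | _ => simp only [outside]; split_ifs <;> omega

theorem exists_outside_eq_zero {A B : FormalAdj V} {p q : Path A B}
    (t : (polygraph E).Term p q) : ∃ n : ℕ, tweight (outside n n) t.total = 0 := by
  have mono : ∀ {A B : FormalAdj V} {m n : ℕ} (_ : m ≤ n) (X : (polygraph E).free.Total A B),
      tweight (outside m m) X = 0 → tweight (outside n n) X = 0 := by
    intro A B m n h X hX
    have := tweight_le_add (E := (polygraph E).toTwoPolygraph) (outside n n) (outside m m)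
      (outside m m) (outside_antitone h h) X
    rwa [hX, Nat.le_zero] at this
  induction t with
  | gen α =>
    cases α with
    | base α => exact ⟨0, rfl⟩
    -- The `+ 1` is needed because the lower bound of the interval is strict.
    | unit x => exact ⟨(wind x).natAbs + 1, if_pos (by omega)⟩
    | counit x => exact ⟨(wind x).natAbs + 1, if_pos (by omega)⟩
  | id f => exact ⟨0, rfl⟩
  | vcomp s t hs ht =>
    obtain ⟨m, hm⟩ := hs
    obtain ⟨n, hn⟩ := ht
    refine ⟨max m n, ?_⟩
    rw [Term.total_vcomp, tweight_vc _ rfl, mono (le_max_left m n) _ hm,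
      mono (le_max_right m n) _ hn]
  | hcomp s t hs ht =>
    obtain ⟨m, hm⟩ := hs
    obtain ⟨n, hn⟩ := ht
    refine ⟨max m n, ?_⟩
    rw [Term.total_hcomp, tweight_hc, mono (le_max_left m n) _ hm,
      mono (le_max_right m n) _ hn]

theorem _root_.Quiver.Path.toPath_eq_comp_toPath_comp {W : Type u} [Quiver.{v} W]
    {A B D D' : W} {x : A ⟶ B}
    {s₁ : Path A D} {z : D ⟶ D'} {s₂ : Path D' B} (h : x.toPath = s₁.comp (z.toPath.comp s₂)) :
    A = D ∧ D' = B ∧ x ≍ z ∧ s₁ ≍ (Path.nil : Path A A) ∧ s₂ ≍ (Path.nil : Path B B) := by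
  have hl := congrArg Path.length h
  simp only [Path.length_comp, Path.length_toPath] at hl
  cases s₁ with
  | cons => rw [Path.length_cons] at hl; omega
  | nil =>
    cases s₂ with
    | cons => rw [Path.length_cons] at hl; omega
    | nil =>
      obtain rfl := eq_of_heq (Path.hom_heq_of_cons_eq_cons h)
      exact ⟨rfl, rfl, HEq.rfl, HEq.rfl, HEq.rfl⟩

theorem _root_.Quiver.Path.toPath_comp_toPath_eq {W : Type u} [Quiver.{v} W]
    {A B C D D' : W} {x : A ⟶ B} {y : B ⟶ C}
    {s₁ : Path A D} {z : D ⟶ D'} {s₂ : Path D' C}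
    (h : x.toPath.comp y.toPath = s₁.comp (z.toPath.comp s₂)) :
    (A = D ∧ D' = B ∧ x ≍ z ∧ s₁ ≍ (Path.nil : Path A A) ∧ s₂ ≍ y.toPath) ∨
    (B = D ∧ D' = C ∧ y ≍ z ∧ s₁ ≍ x.toPath ∧ s₂ ≍ (Path.nil : Path C C)) := by
  rcases Path.comp_eq_comp_toPath_comp h with ⟨w, h', rfl⟩ | ⟨w, h', rfl⟩
  · obtain ⟨rfl, rfl, h₁, h₂, h₃⟩ := Path.toPath_eq_comp_toPath_comp h'
    obtain rfl := eq_of_heq h₃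
    exact .inl ⟨rfl, rfl, h₁, h₂, heq_of_eq (Path.nil_comp _)⟩
  · obtain ⟨rfl, rfl, h₁, h₂, h₃⟩ := Path.toPath_eq_comp_toPath_comp h'
    obtain rfl := eq_of_heq h₂
    exact .inr ⟨rfl, rfl, h₁, HEq.rfl, h₃⟩

/-- A letter of nonzero winding number which does not survive is destroyed by a counit. -/
theorem exists_counit {n : ℤ} (hn : n ≠ 0) {A B C D : FormalAdj V} {x : C ⟶ D} {u : Path A C}
    {v : Path D B} {Y : (polygraph E).free.Total A B} (hx : wind x = n)
    (hY : Y.src = u.comp (x.toPath.comp v)) (hY' : NoWind n Y.tgt) :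
    ∃ (C' D' : FormalAdj V) (y : C' ⟶ D') (s₁ : Path C' C) (s₂ : Path D C') (u₁ : Path A C')
      (v₁ : Path C' B) (X : (polygraph E).free.Total A C) (Z : (polygraph E).free.Total D B)
      (R : (polygraph E).free.Total A B),
      y.toPath.comp (pred y).toPath = s₁.comp (x.toPath.comp s₂) ∧ X.src = u ∧ Z.src = v ∧
      X.tgt = u₁.comp s₁ ∧ Z.tgt = s₂.comp v₁ ∧ R.src = u₁.comp v₁ ∧
      Y = (X ⊠ one _ x.toPath ⊠ Z) ⬝ (one _ u₁ ⊠ counitTotal E y ⊠ one _ v₁) ⬝ R ∧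
      ∀ φ : ∀ {a b : FormalAdj V} {f g : Path a b}, (polygraph E).Gen f g → ℕ,
        φ (Gen₂.counit y) ≤ tweight φ Y := by
  rcases follow (E := (polygraph E).toTwoPolygraph) Y u x v hY with ⟨X, Z, hX, hZ, rfl⟩ |
    ⟨e, e', f, g, α, s₁, s₂, u₁, v₁, X, Z, R, hf, hX, hZ, hX', hZ', hR, hXZ⟩
  -- A surviving letter would occur in the target, which `hY'` forbids. Of the possible consumers
  -- below, `base` has a source of winding number zero and `unit` an empty one.
  · simp [hx, -Path.comp_toPath_eq_cons] at hY'
  · cases α with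
    | @base _ _ f g α =>
      have := noWind_mapPath_zero hn f
      rw [hf] at this
      simp [hx, -Path.comp_toPath_eq_cons] at this
    | unit y =>
      have := congrArg (NoWind n) hf
      simp [hx, -Path.comp_toPath_eq_cons] at this
    | counit y =>
      -- The final clause, for an arbitrary weight, will be used with `outside` to bound the winding
      -- number of `y`.
      refine ⟨_, _, y, s₁, s₂, u₁, v₁, X, Z, R, hf, hX, hZ, hX', hZ', by rw [hR]; simp, hXZ,
        fun φ => ?_⟩
      rw [hXZ, tweight_vc, tweight_vc, tweight_hc _ (one _ u₁), tweight_hc _ (genTotal _)]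
      · have : tweight φ (genTotal (E := (polygraph E).toTwoPolygraph) (Gen₂.counit y)) =
          φ (Gen₂.counit y) := rfl
        omega
      · simp [hR, genTotal, -Path.comp_toPath_eq_cons]
      · rw [vc_src]
        change _ = u₁.comp ((y.toPath.comp (pred y).toPath).comp v₁)
        simp [hX', hZ', hf, -Path.comp_toPath_eq_cons]

/-- In a 2-cell all of whose units and counits have winding numbers at most `n`, a letter of
winding number `n` which is created by a unit and destroyed later can be straightened. -/
theorem reducible_of_top {m n : ℕ} {A B C D : FormalAdj V} {x : C ⟶ D} {u : Path A D}
    {v : Path D B} {Y : (polygraph E).free.Total A B} (hx : wind x = n + 1)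
    (hY : Y.src = u.comp (((pred x).toPath.comp x.toPath).comp v)) (hY' : NoWind (n + 1) Y.tgt)
    (hw : tweight (outside m (n + 1)) Y = 0) :
    Reducible ((one _ u ⊠ unitTotal E x ⊠ one _ v) ⬝ Y) := by
  obtain ⟨C', D', y, s₁, s₂, u₁, v₁, X, Z, R, hf, hX, hZ, hX', hZ', hR, rfl, hy⟩ :=
    exists_counit (u := u.comp (pred x).toPath) (v := v) (by omega) hx
      (by rw [hY, Path.comp_assoc, Path.comp_assoc]) hY'
  -- The consuming counit has source `y ⊗ pred y`, so `x` is `y` or `pred y`. In the first case unit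
  -- and counit belong to the same letter and bound the left zigzag.
  rcases Path.toPath_comp_toPath_eq hf with ⟨rfl, rfl, h, h₁, h₂⟩ | ⟨rfl, rfl, h, h₁, h₂⟩
  · obtain rfl := eq_of_heq h
    obtain rfl := eq_of_heq h₁
    obtain rfl := eq_of_heq h₂
    rw [Path.comp_nil] at hX'
    have e₁ : (one _ u ⊠ unitTotal E y ⊠ one _ v).tgt = (X ⊠ one _ y.toPath ⊠ Z).src := by
      simp [hX, hZ, unitTotal, genTotal, -Path.comp_toPath_eq_cons]
    have e₂ : (X ⊠ one _ y.toPath ⊠ Z).tgt =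
        (one _ u₁ ⊠ counitTotal E y ⊠ one _ v₁).src := by
      simp [hX', hZ', counitTotal, genTotal, -Path.comp_toPath_eq_cons]
    have e₃ : (one _ u₁ ⊠ counitTotal E y ⊠ one _ v₁).tgt = R.src := by
      simp [hR, counitTotal, genTotal, -Path.comp_toPath_eq_cons]
    rw [← vc_assoc e₂ e₃, ← vc_assoc (by rwa [vc_src]) (by rwa [vc_tgt e₂]),
      zigzag_left (C := (polygraph E).free) (η := unitTotal E y) (ε := counitTotal E y) (v₁ := v₁)
        rfl rfl rfl rfl hX hX' hZ hZ']
    have e₄ : ((unitTotal E y ⊠ one _ (pred y).toPath) ⬝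
        (one _ (pred y).toPath ⊠ counitTotal E y)).tgt = (pred y).toPath :=
      (vc_tgt rfl).trans rfl
    refine Reducible.vc_right (Reducible.vc_left (Reducible.vc_right ?_ _ ?_) _ ?_) _ ?_
    · exact ((reducible_left y).hc_right _).hc_left _
    · rw [hc_tgt, hc_tgt, e₄]
      simp [hX, -Path.comp_toPath_eq_cons]
    · simp [hZ', unitTotal, genTotal, -Path.comp_toPath_eq_cons]
    · rw [vc_tgt, vc_tgt, hR]
      · simp [hX', -Path.comp_toPath_eq_cons]
      · rw [hc_tgt, hc_tgt, e₄]
        simp [hX, -Path.comp_toPath_eq_cons]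
      · simp [hZ', unitTotal, genTotal, -Path.comp_toPath_eq_cons]
  -- If `x = pred y`, then `wind y = n + 2`, which `hw` excludes.
  · obtain rfl := eq_of_heq h
    have := hy (outside m (n + 1))
    rw [hw, Nat.le_zero] at this
    simp [outside, -Path.comp_toPath_eq_cons] at this hx
    omega

/-- In a 2-cell all of whose units and counits have winding numbers at least `-m`, a letter of
winding number `-m` which is created by a unit and destroyed later can be straightened. -/
theorem reducible_of_bot {m n : ℕ} {A B C D : FormalAdj V} {x : C ⟶ D} {u : Path A D}
    {v : Path D B} {Y : (polygraph E).free.Total A B} (hx : wind (pred x) = -(m + 1))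
    (hY : Y.src = u.comp (((pred x).toPath.comp x.toPath).comp v))
    (hY' : NoWind (-(m + 1)) Y.tgt) (hw : tweight (outside (m + 1) n) Y = 0) :
    Reducible ((one _ u ⊠ unitTotal E x ⊠ one _ v) ⬝ Y) := by
  obtain ⟨C', D', y, s₁, s₂, u₁, v₁, X, Z, R, hf, hX, hZ, hX', hZ', hR, rfl, hy⟩ :=
    exists_counit (u := u) (v := x.toPath.comp v) (by omega) hx
      (by rw [hY, Path.comp_assoc]) hY'
  rcases Path.toPath_comp_toPath_eq hf with ⟨rfl, rfl, h, h₁, h₂⟩ | ⟨rfl, rfl, h, h₁, h₂⟩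
  -- If the consumed letter `pred x` is `y`, then `wind y = -(m + 1)` misses the strict lower bound
  -- in `hw`. In the other case `pred y = pred x`, so the counit belongs to `x` and the right zigzag
  -- appears.
  · obtain rfl := eq_of_heq h
    have := hy (outside (m + 1) n)
    rw [hw, Nat.le_zero] at this
    simp [outside, -Path.comp_toPath_eq_cons] at this hx
    omega
  · obtain rfl := pred_injective (eq_of_heq h)
    obtain rfl := eq_of_heq h₁
    obtain rfl := eq_of_heq h₂
    rw [Path.nil_comp] at hZ'
    have e₁ : (one _ u ⊠ unitTotal E y ⊠ one _ v).tgt =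
        (X ⊠ one _ (pred y).toPath ⊠ Z).src := by
      simp [hX, hZ, unitTotal, genTotal, -Path.comp_toPath_eq_cons]
    have e₂ : (X ⊠ one _ (pred y).toPath ⊠ Z).tgt =
        (one _ u₁ ⊠ counitTotal E y ⊠ one _ v₁).src := by
      simp [hX', hZ', counitTotal, genTotal, -Path.comp_toPath_eq_cons]
    have e₃ : (one _ u₁ ⊠ counitTotal E y ⊠ one _ v₁).tgt = R.src := by
      simp [hR, counitTotal, genTotal, -Path.comp_toPath_eq_cons]
    rw [← vc_assoc e₂ e₃, ← vc_assoc (by rwa [vc_src]) (by rwa [vc_tgt e₂]),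
      zigzag_right (C := (polygraph E).free) (η := unitTotal E y) (ε := counitTotal E y)
        (v₁ := v₁) rfl rfl rfl rfl hX hX' hZ hZ']
    have e₄ : ((one _ y.toPath ⊠ unitTotal E y) ⬝ (counitTotal E y ⊠ one _ y.toPath)).tgt =
        y.toPath :=
      (vc_tgt (by simp [unitTotal, counitTotal, genTotal, -Path.comp_toPath_eq_cons])).trans
        (by simp [counitTotal, genTotal, -Path.comp_toPath_eq_cons])
    refine Reducible.vc_right (Reducible.vc_left (Reducible.vc_right ?_ _ ?_) _ ?_) _ ?_
    · exact ((reducible_right y).hc_right _).hc_left _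
    · rw [hc_tgt, hc_tgt, e₄]
      simp [hZ, -Path.comp_toPath_eq_cons]
    · simp [hX', unitTotal, genTotal, -Path.comp_toPath_eq_cons]
    · rw [vc_tgt, vc_tgt, hR]
      · simp [hZ', -Path.comp_toPath_eq_cons]
      · rw [hc_tgt, hc_tgt, e₄]
        simp [hZ, -Path.comp_toPath_eq_cons]
      · simp [hX', unitTotal, genTotal, -Path.comp_toPath_eq_cons]

theorem first_unit_spec {A B C D : FormalAdj V} {x : C ⟶ D} {u : Path A D} {v : Path D B}
    {X Y T : (polygraph E).free.Total A B}
    (hT : T = X ⬝ (one _ u ⊠ unitTotal E x ⊠ one _ v) ⬝ Y) (hX : X.tgt = u.comp v)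
    (hY : Y.src = u.comp (((pred x).toPath.comp x.toPath).comp v))
    (φ : ∀ {a b : FormalAdj V} {f g : Path a b}, (polygraph E).Gen f g → ℕ) :
    X.tgt = (one _ u ⊠ unitTotal E x ⊠ one _ v).src ∧
    (one _ u ⊠ unitTotal E x ⊠ one _ v).tgt = Y.src ∧ T.tgt = Y.tgt ∧
    φ (Gen₂.unit x) ≤ tweight φ T ∧ tweight φ Y ≤ tweight φ T := by
  have e₁ : X.tgt = (one _ u ⊠ unitTotal E x ⊠ one _ v).src :=
    hX.trans (by simp [unitTotal, genTotal])
  have e₂ : (one _ u ⊠ unitTotal E x ⊠ one _ v).tgt = Y.src := hY.symm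
  have e₃ : tweight φ (unitTotal E x) = φ (Gen₂.unit x) := rfl
  have e₄ : tweight φ T = tweight φ (X ⬝ (one _ u ⊠ unitTotal E x ⊠ one _ v) ⬝ Y) := by rw [hT]
  rw [tweight_vc _ (by rwa [vc_src]), tweight_vc _ e₂, tweight_hc, tweight_hc, e₃] at e₄
  refine ⟨e₁, e₂, ?_, ?_, ?_⟩
  · rw [hT, vc_tgt (by rwa [vc_src]), vc_tgt e₂]
  · omega
  · omega

/-- The interval of admissible winding numbers is shrunk one end at a time: the lower end until `m =
0`, then the upper end until it is empty. Whenever an end cannot be removed, a letter at that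
extreme yields a redex. -/
theorem unitOrCounit_eq_zero_or_reducible (m : ℕ) : ∀ (n : ℕ) {A B : V} {f g : Path A B}
    (X : (polygraph E).free.Total ((zero V).obj A) ((zero V).obj B)),
    X.src = (zero V).mapPath f → X.tgt = (zero V).mapPath g → tweight (outside m n) X = 0 →
      tweight isUnitOrCounit X = 0 ∨ Reducible X := by
  induction m with
  | zero =>
    intro n
    induction n with
    | zero =>
      intro A B f g X _ _ h
      have := tweight_le_add (E := (polygraph E).toTwoPolygraph) isUnitOrCounit (outside 0 0)
        (outside 0 0) outside_zero X
      rw [h] at this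
      omega
    | succ n ih =>
      intro A B f g X hf hg h
      obtain ⟨p, q, ⟨t⟩⟩ := X
      change p = _ at hf
      change q = _ at hg
      change tweight _ t.total = 0 at h
      change tweight _ t.total = 0 ∨ Reducible t.total
      rcases exists_first_unit (n := n + 1) (by omega) t
        (hf ▸ noWind_mapPath_zero (by omega) f) with ⟨h', -⟩ | ⟨C, D, x, u, v, X, Y, hx, hX, hY, ht⟩
      · refine ih t.total hf hg ?_
        have := tweight_le_add (E := (polygraph E).toTwoPolygraph) (outside 0 n)
          (outside 0 (n + 1)) (touches (n + 1)) (outside_le_left 0 n) t.total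
        rw [h, h'] at this
        omega
      · refine .inr ?_
        obtain ⟨e₁, e₂, e₃, e₄, e₅⟩ := first_unit_spec ht hX hY (outside 0 (n + 1))
        rw [h, Nat.le_zero] at e₄ e₅
        rw [ht]
        refine (reducible_of_top (m := 0) (n := n) ?_ hY ?_ e₅).vc_left _ (by rwa [vc_src])
        -- The unit involves `n + 1` as `wind x` or as `wind (pred x)`; the latter means `wind x = n
        -- + 2`, outside the interval.
        · simp [outside] at e₄ hx
          omega
        · rw [← e₃, show t.total.tgt = (zero V).mapPath g from hg]
          exact noWind_mapPath_zero (by omega) g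
  | succ m ih =>
    intro n A B f g X hf hg h
    obtain ⟨p, q, ⟨t⟩⟩ := X
    change p = _ at hf
    change q = _ at hg
    change tweight _ t.total = 0 at h
    change tweight _ t.total = 0 ∨ Reducible t.total
    rcases exists_first_unit (n := -(m + 1)) (by omega) t
      (hf ▸ noWind_mapPath_zero (by omega) f) with ⟨h', -⟩ | ⟨C, D, x, u, v, X, Y, hx, hX, hY, ht⟩
    · refine ih n t.total hf hg ?_
      have := tweight_le_add (E := (polygraph E).toTwoPolygraph) (outside m n)
        (outside (m + 1) n) (touches (-(m + 1))) (outside_le_right m n) t.total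
      rw [h, h'] at this
      omega
    · refine .inr ?_
      obtain ⟨e₁, e₂, e₃, e₄, e₅⟩ := first_unit_spec ht hX hY (outside (m + 1) n)
      rw [h, Nat.le_zero] at e₄ e₅
      rw [ht]
      refine (reducible_of_bot (m := m) (n := n) ?_ hY ?_ e₅).vc_left _ (by rwa [vc_src])
      -- Here `wind x = -(m + 1)` is excluded by the strict lower bound, so the extreme letter is
      -- `pred x`.
      · simp [outside] at e₄ hx ⊢
        omega
      · rw [← e₃, show t.total.tgt = (zero V).mapPath g from hg]
        exact noWind_mapPath_zero (by omega) g

/-- A 2-cell between 1-cells of winding number zero which contains a unit or a counit can be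
rewritten. -/
theorem unitCounitCount_eq_zero {A B : V} {f g : Path A B}
    {α : (polygraph E).free.Cell ((zero V).mapPath f) ((zero V).mapPath g)}
    (h : (polygraph E).IsNormalForm α) : unitCounitCount α = 0 := by
  obtain ⟨n, hn⟩ : ∃ n : ℕ, tweight (outside n n)
      (⟨_, _, α⟩ : (polygraph E).free.Total ((zero V).obj A) ((zero V).obj B)) = 0 := by
    obtain ⟨t⟩ := α
    exact exists_outside_eq_zero t
  rcases unitOrCounit_eq_zero_or_reducible n n ⟨_, _, α⟩ rfl rfl hn with h' | ⟨β, hβ⟩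
  · exact h'
  · exact (h β hβ).elim

end

end FormalAdj

/-! ### Functoriality on bundled cells, and weights under substitution -/

namespace TwoPolygraph

open PathTwoCat PathTwoCat.Total

section

variable {V : Type u} [Quiver.{v} V] {W : Type u'} [Quiver.{v'} W] {E : TwoPolygraph.{w} V}

local infixr:70 " ⊠ " => Total.hc
local infixr:65 " ⬝ " => Total.vc

/-- The image of a 2-cell under the 2-functor `lift φ C σ`, with its boundary. -/
def liftTotal (φ : V ⥤q W) (C : PathTwoCat.{w'} W)
    (σ : ∀ {a b : V} {f g : Path a b}, E.Gen f g → C.Cell (φ.mapPath f) (φ.mapPath g))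
    {a b : V} {f g : Path a b} (α : E.free.Cell f g) : C.Total (φ.obj a) (φ.obj b) :=
  ⟨φ.mapPath f, φ.mapPath g, eval (C.comap φ) σ α⟩

section

variable (φ : V ⥤q W) (C : PathTwoCat.{w'} W)
  (σ : ∀ {a b : V} {f g : Path a b}, E.Gen f g → C.Cell (φ.mapPath f) (φ.mapPath g))

theorem liftTotal_vcomp {a b : V} {f g h : Path a b} (α : E.free.Cell f g)
    (β : E.free.Cell g h) :
    liftTotal φ C σ (E.free.vcomp α β) = liftTotal φ C σ α ⬝ liftTotal φ C σ β := by
  exact (congrArg (fun γ : C.Cell _ _ => (⟨_, _, γ⟩ : C.Total (φ.obj a) (φ.obj b)))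
    (eval_vcomp (C.comap φ) σ α β)).trans (mk_vc_mk (C := C) _ _).symm

theorem liftTotal_hcomp {a b c : V} {f f' : Path a b} {g g' : Path b c} (α : E.free.Cell f f')
    (β : E.free.Cell g g') :
    liftTotal φ C σ (E.free.hcomp α β) = liftTotal φ C σ α ⊠ liftTotal φ C σ β := by
  exact (congrArg (fun γ : C.Cell _ _ => (⟨_, _, γ⟩ : C.Total (φ.obj a) (φ.obj c)))
    (eval_hcomp (C.comap φ) σ α β)).trans
    (mk_castCell (C := C) _ _ _)

end

/-- The weights on `E[f ⇒ g]` which agree with `φ` on `E` and vanish on the metavariable. -/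
def oldWeight (φ : ∀ {a b : V} {f g : Path a b}, E.Gen f g → ℕ) {a b : V} {f g : Path a b}
    {c d : V} {h k : Path c d} : (E.adjoin f g).Gen h k → ℕ
  | AdjoinGen.old α => φ α
  | AdjoinGen.var => 0

/-- The number of occurrences of the metavariable is left arbitrary, since the subterms of a unary
context need not be unary; `Context.weight_apply` then sets it to `1`. -/
theorem weight_eval_substVar (φ : ∀ {a b : V} {f g : Path a b}, E.Gen f g → ℕ) {a b : V}
    {f g : Path a b} (α : E.free.Cell f g) {c d : V} {h k : Path c d}
    (t : (E.adjoin f g).Term h k) :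
    weight φ (eval E.free (substVar α) (Quot.mk _ t : (E.adjoin f g).free.Cell h k)) =
      weight (oldWeight φ) (Quot.mk _ t : (E.adjoin f g).free.Cell h k) +
        weight isVar (Quot.mk _ t : (E.adjoin f g).free.Cell h k) * weight φ α := by
  induction t with
  | gen β =>
    cases β with
    | old β => exact (by simp : φ β = φ β + 0 * weight φ α)
    | var => exact (by simp : weight φ α = 0 + 1 * weight φ α)
  | id f => exact (by simp : 0 = 0 + 0 * weight φ α)
  | vcomp s t hs ht =>
    refine (weight_vcomp φ _ _).trans ?_
    refine Eq.trans ?_ (congrArg₂ (· + · * weight φ α)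
      (weight_vcomp (E := E.adjoin f g) (oldWeight φ) (Quot.mk _ s) (Quot.mk _ t))
      (weight_vcomp (E := E.adjoin f g) isVar (Quot.mk _ s) (Quot.mk _ t))).symm
    refine (congrArg₂ (· + ·) hs ht).trans ?_
    ring
  | hcomp s t hs ht =>
    refine (weight_hcomp φ _ _).trans ?_
    refine Eq.trans ?_ (congrArg₂ (· + · * weight φ α)
      (weight_hcomp (E := E.adjoin f g) (oldWeight φ) (Quot.mk _ s) (Quot.mk _ t))
      (weight_hcomp (E := E.adjoin f g) isVar (Quot.mk _ s) (Quot.mk _ t))).symm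
    refine (congrArg₂ (· + ·) hs ht).trans ?_
    ring

theorem Context.weight_apply (φ : ∀ {a b : V} {f g : Path a b}, E.Gen f g → ℕ) {a b : V}
    {f g : Path a b} {c d : V} {h k : Path c d} (K : E.Context f g h k) (α : E.free.Cell f g) :
    weight φ (K.apply α) = weight (oldWeight φ) K.cell + weight φ α := by
  obtain ⟨⟨t⟩, hK⟩ := K
  refine (weight_eval_substVar φ α t).trans ?_
  rw [show weight isVar (Quot.mk _ t : (E.adjoin f g).free.Cell h k) = 1 from hK, one_mul]

end

end TwoPolygraph

/-! ### Characterization of normal forms, termination and fullness -/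

namespace FormalAdj

open PathTwoCat PathTwoCat.Total TwoPolygraph

section

variable {V : Type u} [Quiver.{v} V] {E : TwoPolygraph.{w} V}

local infixr:70 " ⊠ " => Total.hc
local infixr:65 " ⬝ " => Total.vc

theorem mapPath_zero_injective {A B : V} {f g : Path A B}
    (h : (zero V).mapPath f = (zero V).mapPath g) : f = g := by
  induction f with
  | nil =>
    cases g with
    | nil => rfl
    | cons g y => cases congrArg Path.length h
  | cons f x ih =>
    cases g with
    | nil => cases congrArg Path.length h
    | cons g y =>
      obtain rfl := Path.obj_eq_of_cons_eq_cons h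
      obtain rfl := ih (eq_of_heq (Path.heq_of_cons_eq_cons h))
      have := eq_of_heq (Path.hom_heq_of_cons_eq_cons h)
      injection this with _ _ h₁
      subst h₁
      rfl

theorem exists_of_comp_eq_mapPath_zero {A B C : V} {p : @Path (FormalAdj V) _ A B}
    {q : @Path (FormalAdj V) _ B C} {f : Path A C} (h : p.comp q = (zero V).mapPath f) :
    ∃ (f₁ : Path A B) (f₂ : Path B C), f = f₁.comp f₂ ∧ p = (zero V).mapPath f₁ ∧
      q = (zero V).mapPath f₂ := by
  induction q with
  | nil => exact ⟨f, Path.nil, rfl, h, rfl⟩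
  | cons q x ih =>
    cases f with
    | nil => cases congrArg Path.length h
    | cons f y =>
      obtain rfl := Path.obj_eq_of_cons_eq_cons h
      obtain rfl := eq_of_heq (Path.hom_heq_of_cons_eq_cons h)
      obtain ⟨f₁, f₂, rfl, rfl, rfl⟩ := ih (eq_of_heq (Path.heq_of_cons_eq_cons h))
      exact ⟨f₁, f₂.cons y, rfl, rfl, rfl⟩

/-- The 2-cell `α^0`, with its boundary. -/
def zeroTotal {A B : V} {f g : Path A B} (α : E.free.Cell f g) :
    (polygraph E).free.Total A B :=
  liftTotal (zero V) (polygraph E).free (fun α => (polygraph E).of (Gen₂.base α)) α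

/-- Only generators `α^0` occur, and they keep winding numbers at zero. The target is produced
rather than prescribed, because the intermediate 1-cell of a vertical composite is not known in
advance to be some `k^0`. -/
theorem exists_zeroTotal_eq {A B : FormalAdj V} {p q : Path A B} (t : (polygraph E).Term p q) :
    ∀ f : @Path V _ A B, p = (zero V).mapPath f → tweight isUnitOrCounit t.total = 0 →
      ∃ (g : @Path V _ A B) (α : E.free.Cell f g), t.total = zeroTotal α := by
  induction t with
  | gen α =>
    intro f hf h
    cases α with
    | base α =>
      obtain rfl := mapPath_zero_injective hf
      exact ⟨_, E.of α, rfl⟩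
    | unit x => cases h
    | counit x => cases h
  | id p =>
    rintro f rfl -
    exact ⟨f, E.free.id f, rfl⟩
  | vcomp s t hs ht =>
    intro f hf h
    rw [Term.total_vcomp, tweight_vc _ rfl] at h
    obtain ⟨g, α, hα⟩ := hs f hf (by omega)
    obtain ⟨k, β, hβ⟩ := ht g (congrArg Total.tgt hα) (by omega)
    exact ⟨k, E.free.vcomp α β, by
      rw [Term.total_vcomp, hα, hβ]; exact (liftTotal_vcomp _ _ _ α β).symm⟩
  | hcomp s t hs ht =>
    intro f hf h
    rw [Term.total_hcomp, tweight_hc] at h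
    obtain ⟨f₁, f₂, rfl, h₁, h₂⟩ :=
      exists_of_comp_eq_mapPath_zero (V := V) hf
    obtain ⟨g, α, hα⟩ := hs f₁ h₁ (by omega)
    obtain ⟨k, β, hβ⟩ := ht f₂ h₂ (by omega)
    exact ⟨g.comp k, E.free.hcomp α β, by
      rw [Term.total_hcomp, hα, hβ]; exact (liftTotal_hcomp _ _ _ α β).symm⟩

theorem exists_map₂_toFree_eq {A B : E.free.Obj} {f g : A ⟶ B}
    (α : (toFree E).map f ⟶ (toFree E).map g) (h : unitCounitCount α = 0) :
    ∃ β : f ⟶ g, (toFree E).map₂ β = α := by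
  obtain ⟨t⟩ := α
  obtain ⟨g', β, hβ⟩ := exists_zeroTotal_eq t f rfl h
  obtain rfl := mapPath_zero_injective (congrArg Total.tgt hβ)
  exact ⟨β, (eq_of_heq (heq_of_mk_eq hβ)).symm⟩

theorem unitCounitCount_map₂_toFree {A B : E.free.Obj} {f g : A ⟶ B} (α : f ⟶ g) :
    unitCounitCount ((toFree E).map₂ α) = 0 := by
  have key : ∀ {A B : V} {f g : Path A B} (t : E.Term f g),
      tweight isUnitOrCounit (zeroTotal (Quot.mk _ t : E.free.Cell f g)) = 0 := by
    intro A B f g t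
    induction t with
    | gen α => rfl
    | id f => rfl
    | vcomp s t hs ht =>
      refine (congrArg (tweight _) (liftTotal_vcomp (zero V) (polygraph E).free
        (fun α => (polygraph E).of (Gen₂.base α)) (Quot.mk _ s) (Quot.mk _ t))).trans ?_
      refine (tweight_vc (E := (polygraph E).toTwoPolygraph) _ rfl).trans ?_
      exact (congrArg₂ (· + ·) hs ht)
    | hcomp s t hs ht =>
      refine (congrArg (tweight _) (liftTotal_hcomp (zero V) (polygraph E).free
        (fun α => (polygraph E).of (Gen₂.base α)) (Quot.mk _ s) (Quot.mk _ t))).trans ?_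
      refine (tweight_hc (E := (polygraph E).toTwoPolygraph) _ _ _).trans ?_
      exact (congrArg₂ (· + ·) hs ht)
  obtain ⟨t⟩ := α
  exact key t

/-- Either rule replaces one unit and one counit by an identity, and the context contributes equally
on both sides. This is also the termination argument. -/
theorem Step.unitCounitCount {A B : FormalAdj V} {f g : Path A B}
    {α β : (polygraph E).free.Cell f g} (h : (polygraph E).Step α β) :
    unitCounitCount α = unitCounitCount β + 2 := by
  obtain ⟨r, K⟩ := h
  refine (K.weight_apply isUnitOrCounit _).trans ?_
  refine Eq.trans ?_ (congrArg (· + 2) (K.weight_apply isUnitOrCounit _).symm)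
  rw [add_assoc]
  congr 1
  cases r <;> rfl

/-- For the converse direction, a step lowers the count by two, so none can start at count zero. -/
theorem isNormalForm_iff {A B : E.free.Obj} {f g : A ⟶ B}
    (α : (toFree E).map f ⟶ (toFree E).map g) :
    (polygraph E).IsNormalForm α ↔ unitCounitCount α = 0 := by
  refine ⟨unitCounitCount_eq_zero (f := f) (g := g), fun h β hβ => ?_⟩
  have := Step.unitCounitCount hβ
  rw [show FormalAdj.unitCounitCount α = 0 from h] at this
  omega

/-- The class of a 2-cell in the presented 2-category, with its boundary. -/
def _root_.ThreePolygraph.classTotal {W : Type u'} [Quiver.{v'} W] (F : ThreePolygraph.{w'} W)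
    {a b : W} (A : F.free.Total a b) : F.presented.Total a b :=
  ⟨A.src, A.tgt, Quot.mk _ A.cell⟩

theorem _root_.ThreePolygraph.classTotal_vc {W : Type u'} [Quiver.{v'} W]
    (F : ThreePolygraph.{w'} W) {a b : W} {A B : F.free.Total a b} (h : A.tgt = B.src) :
    F.classTotal (A ⬝ B) = F.classTotal A ⬝ F.classTotal B := by
  obtain ⟨f, g, α⟩ := A; obtain ⟨g', k, β⟩ := B
  obtain rfl : g = g' := h
  rw [mk_vc_mk]
  exact (mk_vc_mk (C := F.presented) (Quot.mk _ α) (Quot.mk _ β)).symm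

theorem _root_.ThreePolygraph.classTotal_liftTotal {W : Type u'} [Quiver.{v'} W]
    (F : ThreePolygraph.{w'} W) (φ : V ⥤q W)
    (σ : ∀ {a b : V} {f g : Path a b}, E.Gen f g → F.free.Cell (φ.mapPath f) (φ.mapPath g))
    {a b : V} {f g : Path a b} (t : E.Term f g) :
    liftTotal φ F.presented (fun α => Quot.mk _ (σ α)) (Quot.mk _ t : E.free.Cell f g) =
      F.classTotal (liftTotal φ F.free σ (Quot.mk _ t : E.free.Cell f g)) := by
  induction t with
  | gen α => rfl
  | id f => rfl
  | vcomp s t hs ht =>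
    refine (liftTotal_vcomp _ _ _ (Quot.mk _ s) (Quot.mk _ t)).trans ?_
    refine Eq.trans ?_ (congrArg _ (liftTotal_vcomp φ F.free σ (Quot.mk _ s) (Quot.mk _ t)).symm)
    rw [F.classTotal_vc rfl, hs, ht]
  | hcomp s t hs ht =>
    refine (liftTotal_hcomp _ _ _ (Quot.mk _ s) (Quot.mk _ t)).trans ?_
    refine Eq.trans ?_ (congrArg _ (liftTotal_hcomp φ F.free σ (Quot.mk _ s) (Quot.mk _ t)).symm)
    rw [hs, ht]
    rfl

theorem embedding_map₂ {A B : E.free.Obj} {f g : A ⟶ B} (α : f ⟶ g) :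
    (embedding E).map₂ α = Quot.mk _ ((toFree E).map₂ α) := by
  obtain ⟨t⟩ := α
  exact eq_of_heq (heq_of_mk_eq ((polygraph E).classTotal_liftTotal (zero V)
    (fun α => (polygraph E).of (Gen₂.base α)) t))

/-- Rewriting does not change the class and lowers the count; it ends at a normal form, which comes
from `E^*`. -/
theorem exists_embedding_map₂_eq {A B : E.free.Obj} {f g : A ⟶ B} : ∀ (n : ℕ)
    (α : (toFree E).map f ⟶ (toFree E).map g), unitCounitCount α = n →
    ∃ β : f ⟶ g, (embedding E).map₂ β = Quot.mk _ α := by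
  intro n
  induction n using Nat.strong_induction_on with
  | _ n ih =>
    intro α hα
    by_cases h : (polygraph E).IsNormalForm α
    · obtain ⟨β, rfl⟩ := exists_map₂_toFree_eq α ((isNormalForm_iff α).1 h)
      exact ⟨β, embedding_map₂ β⟩
    · simp only [ThreePolygraph.IsNormalForm, not_forall, not_not] at h
      obtain ⟨β, hβ⟩ := h
      have := Step.unitCounitCount hβ
      obtain ⟨γ, hγ⟩ := ih (FormalAdj.unitCounitCount β) (by omega) β rfl
      exact ⟨γ, hγ.trans (Quot.sound hβ).symm⟩

end

end FormalAdj

/-! ### Target 2-categories for the semantic argument -/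

namespace PathTwoCat

open PathTwoCat.Total

section

variable {V : Type u} [Quiver.{v} V]

theorem some_heq (C : PathTwoCat.{w} V) {a b : V} {p q p' q' : Path a b} (hp : p = p')
    (hq : q = q') {x : C.Cell p q} {y : C.Cell p' q'} (h : x ≍ y) :
    (some x : Option (C.Cell p q)) ≍ some y := by
  subst hp hq
  rw [eq_of_heq h]

theorem none_heq (C : PathTwoCat.{w} V) {a b : V} {p q p' q' : Path a b} (hp : p = p')
    (hq : q = q') : (none : Option (C.Cell p q)) ≍ (none : Option (C.Cell p' q')) := by
  subst hp hq
  rfl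

theorem map_heq (C : PathTwoCat.{w} V) {a b : V} {p q p' q' : Path a b} (hp : p = p')
    (hq : q = q') (F : C.Cell p' q' → C.Cell p q) (hF : ∀ x, F x ≍ x)
    (α : Option (C.Cell p' q')) : α.map F ≍ α := by
  subst hp hq
  cases α
  · rfl
  · exact heq_of_eq (congrArg some (eq_of_heq (hF _)))

/-- The 2-category with one more 2-cell in every hom-set, absorbing for both compositions. -/
def withBot (C : PathTwoCat.{w} V) : PathTwoCat.{w} V where
  Cell f g := Option (C.Cell f g)
  id f := some (C.id f)
  vcomp := Option.map₂ C.vcomp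
  hcomp := Option.map₂ C.hcomp
  id_vcomp α := by cases α <;> simp [C.id_vcomp]
  vcomp_id α := by cases α <;> simp [C.vcomp_id]
  vcomp_assoc α β γ := by cases α <;> cases β <;> cases γ <;> simp [C.vcomp_assoc]
  hcomp_ids f g := congrArg some (C.hcomp_ids f g)
  interchange α α' β β' := by
    cases α <;> cases α' <;> cases β <;> cases β' <;> simp [C.interchange]
  hcomp_assoc {_ _ _ _ f f' g g' h h'} α β γ := by
    cases α <;> cases β <;> cases γ <;>
      first
      | exact C.some_heq (Path.comp_assoc _ _ _) (Path.comp_assoc _ _ _) (C.hcomp_assoc _ _ _)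
      | exact C.none_heq (Path.comp_assoc _ _ _) (Path.comp_assoc _ _ _)
  id_hcomp {a b f f'} α := by
    have h := C.map_heq (Path.nil_comp f) (Path.nil_comp f') (C.hcomp (C.id Path.nil))
      C.id_hcomp α
    cases α <;> exact h
  hcomp_id {a b f f'} α := by
    have h := C.map_heq (Path.comp_nil f) (Path.comp_nil f') (fun x => C.hcomp x (C.id Path.nil))
      C.hcomp_id α
    cases α <;> exact h

/-! ### 2-categories of functors -/

section

variable (M : V → Type m) [∀ a, Category.{n} (M a)] (L : ∀ {a b : V}, (a ⟶ b) → M a ⥤ M b)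

/-- The composite of the functors assigned to the letters of a path. -/
def pathFunctor {a : V} : ∀ {b : V}, Path a b → M a ⥤ M b
  | _, .nil => 𝟭 _
  | _, .cons p e => pathFunctor p ⋙ L e

theorem pathFunctor_comp {a b c : V} (p : Path a b) (q : Path b c) :
    pathFunctor M L (p.comp q) = pathFunctor M L p ⋙ pathFunctor M L q := by
  induction q with
  | nil => rfl
  | cons q e ih => exact congrArg (· ⋙ L e) ih

theorem natTrans_hcomp_heq {A B D : Type m} [Category.{n} A] [Category.{n} B] [Category.{n} D]
    {F F' G G' : A ⥤ B} {H H' K K' : B ⥤ D} (hF : F = F') (hG : G = G') (hH : H = H')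
    (hK : K = K') {α : F ⟶ G} {α' : F' ⟶ G'} {β : H ⟶ K} {β' : H' ⟶ K'} (hα : α ≍ α')
    (hβ : β ≍ β') : NatTrans.hcomp α β ≍ NatTrans.hcomp α' β' := by
  subst hF hG hH hK
  rw [eq_of_heq hα, eq_of_heq hβ]

theorem comp_heq_comp {A : Type*} [Category* A] {X Y Z X' Y' Z' : A} (hX : X = X') (hY : Y = Y')
    (hZ : Z = Z') {f : X ⟶ Y} {g : Y ⟶ Z} {f' : X' ⟶ Y'} {g' : Y' ⟶ Z'} (hf : f ≍ f')
    (hg : g ≍ g') : f ≫ g ≍ f' ≫ g' := by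
  subst hX hY hZ
  rw [eq_of_heq hf, eq_of_heq hg]

theorem eqToHom_conj_heq {A : Type*} [Category* A] {X Y X' Y' : A} (hX : X' = X) (hY : Y = Y')
    (f : X ⟶ Y) : eqToHom hX ≫ f ≫ eqToHom hY ≍ f := by
  subst hX hY
  simp

/-- Horizontal composition of natural transformations between path functors. -/
def pathHcomp {a b c : V} {f f' : Path a b} {g g' : Path b c}
    (α : pathFunctor M L f ⟶ pathFunctor M L f') (β : pathFunctor M L g ⟶ pathFunctor M L g') :
    pathFunctor M L (f.comp g) ⟶ pathFunctor M L (f'.comp g') :=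
  eqToHom (pathFunctor_comp M L f g) ≫ NatTrans.hcomp α β ≫
    eqToHom (pathFunctor_comp M L f' g').symm

theorem pathHcomp_heq {a b c : V} {f f' : Path a b} {g g' : Path b c}
    (α : pathFunctor M L f ⟶ pathFunctor M L f') (β : pathFunctor M L g ⟶ pathFunctor M L g') :
    pathHcomp M L α β ≍ NatTrans.hcomp α β :=
  eqToHom_conj_heq _ _ _

/-- The 2-category whose 2-cells are the natural transformations between path functors. -/
def functors : PathTwoCat.{max m n} V where
  Cell f g := pathFunctor M L f ⟶ pathFunctor M L g
  id f := 𝟙 _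
  vcomp α β := α ≫ β
  hcomp α β := pathHcomp M L α β
  id_vcomp α := Category.id_comp α
  vcomp_id α := Category.comp_id α
  vcomp_assoc α β γ := Category.assoc α β γ
  hcomp_ids f g := by
    refine eq_of_heq ((pathHcomp_heq M L _ _).trans ?_)
    rw [pathFunctor_comp, show NatTrans.hcomp (𝟙 (pathFunctor M L f)) (𝟙 (pathFunctor M L g)) =
      𝟙 (pathFunctor M L f ⋙ pathFunctor M L g) by ext; simp]
  interchange {_ _ _ f f' f'' g g' g''} α α' β β' := by
    refine eq_of_heq ((pathHcomp_heq M L _ _).trans ?_)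
    rw [NatTrans.exchange]
    exact comp_heq_comp (pathFunctor_comp M L _ _).symm (pathFunctor_comp M L _ _).symm
      (pathFunctor_comp M L _ _).symm (pathHcomp_heq M L _ _).symm (pathHcomp_heq M L _ _).symm
  hcomp_assoc {_ _ _ _ f f' g g' h h'} α β γ := by
    refine (pathHcomp_heq M L _ _).trans (HEq.trans ?_ (pathHcomp_heq M L _ _).symm)
    refine (natTrans_hcomp_heq (pathFunctor_comp M L _ _) (pathFunctor_comp M L _ _) rfl rfl
      (pathHcomp_heq M L α β) HEq.rfl).trans ?_
    refine HEq.trans (heq_of_eq ?_) (natTrans_hcomp_heq rfl rfl (pathFunctor_comp M L _ _)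
      (pathFunctor_comp M L _ _) HEq.rfl (pathHcomp_heq M L β γ)).symm
    ext X
    simp [NatTrans.hcomp]
  id_hcomp {a b f f'} α := by
    refine (pathHcomp_heq M L _ _).trans (heq_of_eq ?_)
    ext X
    exact (congrArg _ ((pathFunctor M L f').map_id X)).trans (Category.comp_id _)
  hcomp_id {a b f f'} α := by
    refine (pathHcomp_heq M L _ _).trans (heq_of_eq ?_)
    ext X
    exact Category.id_comp _

end

end

end PathTwoCat

/-! ### The action of a strict bicategory on presheaves by precomposition -/

namespace CategoryTheory.Bicategory

section

variable {B : Type u} [Bicategory.{max v w, v} B] (X : B)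

/-- Covariant presheaves on the category of morphisms from `a` to `X`. -/
abbrev Psh (a : B) : Type _ := (a ⟶ X) ⥤ Type (max v w)

/-- The functor between presheaf categories induced by a 1-morphism. -/
abbrev star {a b : B} (f : a ⟶ b) : Psh.{w} X a ⥤ Psh.{w} X b :=
  (Functor.whiskeringLeft _ _ _).obj (precomp X f)

/-- The natural transformation induced by a 2-morphism. -/
abbrev starMap {a b : B} {f g : a ⟶ b} (α : f ⟶ g) : star.{w} X f ⟶ star.{w} X g :=
  (Functor.whiskeringLeft _ _ _).map ((precomposing a b X).map α)

theorem starMap_app_app {a b : B} {f g : a ⟶ b} (α : f ⟶ g) (G : Psh.{w} X a) (h : b ⟶ X) :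
    ((starMap.{w} X α).app G).app h = G.map (α ▷ h) := rfl

theorem starMap_id {a b : B} (f : a ⟶ b) : starMap.{w} X (𝟙 f) = 𝟙 _ := by
  refine NatTrans.ext (funext fun G => NatTrans.ext (funext fun h => ?_))
  rw [starMap_app_app, id_whiskerRight, G.map_id]
  rfl

theorem starMap_comp {a b : B} {f g h : a ⟶ b} (α : f ⟶ g) (β : g ⟶ h) :
    starMap.{w} X (α ≫ β) = starMap.{w} X α ≫ starMap.{w} X β := by
  refine NatTrans.ext (funext fun G => NatTrans.ext (funext fun h => ?_))
  rw [starMap_app_app, comp_whiskerRight, G.map_comp]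
  rfl

/-- Yoneda: at the functor corepresented by `f ≫ 𝟙 X`, the identity is sent to `α ▷ 𝟙 X`, which
determines `α`. This needs the target of `f` to be `X`. -/
theorem starMap_injective {a : B} {f g : a ⟶ X} {α β : f ⟶ g}
    (h : starMap.{w} X α = starMap.{w} X β) : α = β := by
  have h₁ := congr_arg (fun θ => (θ.app (coyoneda.obj (.op (f ≫ 𝟙 X)))).app (𝟙 X)) h
  simp only [starMap_app_app] at h₁
  have h₂ := congr_arg (fun θ => θ.hom (𝟙 (f ≫ 𝟙 X))) h₁
  have h₃ : α ▷ 𝟙 X = β ▷ 𝟙 X :=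
    (Category.id_comp _).symm.trans (h₂.trans (Category.id_comp _))
  simpa using h₃

/-- Precomposition with adjoint 1-morphisms. -/
def precompAdjunction {a b : B} {l : a ⟶ b} {r : b ⟶ a} (adj : Bicategory.Adjunction l r) :
    precomp X r ⊣ precomp X l :=
  CategoryTheory.Adjunction.mkOfHomEquiv
    { homEquiv := fun g h => (adj.homEquiv₁ (g := g) (h := h)).symm
      homEquiv_naturality_left_symm := by
        intro g g' h α (β : g' ⟶ l ≫ h)
        change adj.homEquiv₁ (α ≫ β) = r ◁ α ≫ adj.homEquiv₁ β
        simp [Bicategory.Adjunction.homEquiv₁_apply]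
      homEquiv_naturality_right := by
        intro g h h' (α : r ≫ g ⟶ h) β
        change adj.homEquiv₁.symm (α ≫ β) =
          adj.homEquiv₁.symm α ≫ l ◁ β
        simp [Bicategory.Adjunction.homEquiv₁_symm_apply] }

/-- An adjunction between 1-morphisms induces an adjunction between presheaf categories. -/
def starAdjunction {a b : B} {l : a ⟶ b} {r : b ⟶ a} (adj : Bicategory.Adjunction l r) :
    star.{w} X l ⊣ star.{w} X r :=
  -- Precomposition exchanges left and right adjoints, and so does passing to presheaves; the two
  -- reversals cancel.
  (precompAdjunction X adj).whiskerLeft _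

variable [Strict B]

theorem natTrans_heq {A B : Type*} [Category* A] [Category* B] {F G F' G' : A ⥤ B} (hF : F = F')
    (hG : G = G') {α : F ⟶ G} {β : F' ⟶ G'} (h : ∀ x, α.app x ≍ β.app x) : α ≍ β := by
  subst hF hG
  exact heq_of_eq (NatTrans.ext (funext fun x => eq_of_heq (h x)))

theorem map_heq_map {A B : Type*} [Category* A] [Category* B] (F : A ⥤ B) {x y x' y' : A}
    (hx : x = x') (hy : y = y') {f : x ⟶ y} {f' : x' ⟶ y'} (h : f ≍ f') :
    F.map f ≍ F.map f' := by
  subst hx hy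
  rw [eq_of_heq h]

theorem precomp_id (a : B) : precomp X (𝟙 a) = 𝟭 _ := by
  refine Functor.hext (fun h => Strict.id_comp h) fun h k α => ?_
  change 𝟙 a ◁ α ≍ α
  rw [id_whiskerLeft, Strict.leftUnitor_eqToIso, Strict.leftUnitor_eqToIso, eqToIso.hom, eqToIso.inv]
  exact PathTwoCat.eqToHom_conj_heq _ _ _

theorem precomp_comp {a b c : B} (f : a ⟶ b) (g : b ⟶ c) :
    precomp X (f ≫ g) = precomp X g ⋙ precomp X f := by
  refine Functor.hext (fun h => Strict.assoc f g h) fun h k α => ?_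
  change (f ≫ g) ◁ α ≍ f ◁ g ◁ α
  rw [comp_whiskerLeft, Strict.associator_eqToIso, Strict.associator_eqToIso, eqToIso.hom, eqToIso.inv]
  exact PathTwoCat.eqToHom_conj_heq _ _ _

theorem star_id (a : B) : star.{w} X (𝟙 a) = 𝟭 _ := by
  rw [star, precomp_id]; rfl

theorem star_comp {a b c : B} (f : a ⟶ b) (g : b ⟶ c) :
    star.{w} X (f ≫ g) = star.{w} X f ⋙ star.{w} X g := by
  rw [star, precomp_comp]; rfl

/-- The 2-cell on the left is the horizontal composite of `α` and `β`, so `star` respects `⊗` on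
2-cells. The equality is heterogeneous because `star_comp` is an equality of functors. -/
theorem starMap_whisker {a b c : B} {f f' : a ⟶ b} {g g' : b ⟶ c} (α : f ⟶ f') (β : g ⟶ g') :
    starMap.{w} X (f ◁ β ≫ α ▷ g') ≍ NatTrans.hcomp (starMap.{w} X α) (starMap.{w} X β) := by
  refine natTrans_heq (star_comp X f g) (star_comp X f' g') fun G => ?_
  refine natTrans_heq (congrArg (fun F => F.obj G) (star_comp X f g))
    (congrArg (fun F => F.obj G) (star_comp X f' g')) fun h => ?_
  have e : (f ◁ β ≫ α ▷ g') ▷ h ≍ f ◁ β ▷ h ≫ α ▷ (g' ≫ h) := by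
    have : (f ◁ β ≫ α ▷ g') ▷ h =
        (α_ f g h).hom ≫ (f ◁ β ▷ h ≫ α ▷ (g' ≫ h)) ≫ (α_ f' g' h).inv := by simp
    rw [this, Strict.associator_eqToIso, Strict.associator_eqToIso, eqToIso.hom, eqToIso.inv]
    exact PathTwoCat.eqToHom_conj_heq _ _ _
  refine (map_heq_map G (Strict.assoc _ _ _) (Strict.assoc _ _ _) e).trans (heq_of_eq ?_)
  rw [G.map_comp]
  rfl

end

end CategoryTheory.Bicategory

/-! ### Comparing cells over a graph with the natural transformations they induce -/

namespace PathTwoCat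

open PathTwoCat.Total Bicategory

local infixr:70 " ⊠ " => Total.hc
local infixr:65 " ⬝ " => Total.vc

section

variable {V : Type u} [Quiver.{v} V] {C : PathTwoCat.{max u v w} V} (X : C.Obj)
  {W : Type u'} [Quiver.{v'} W] (o : W → C.Obj)
  (L : ∀ {a b : W}, (a ⟶ b) → Psh.{w} X (o a) ⥤ Psh.{w} X (o b))

/-- The 2-cell `S` is the natural transformation induced by the 2-cell `A` of `C`. -/
def Tracks {a b : W} (S : (functors (fun a => Psh.{w} X (o a)) L).withBot.Total a b)
    (A : C.Total (o a) (o b)) : Prop :=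
  ∃ θ : pathFunctor (fun a => Psh.{w} X (o a)) L S.src ⟶
      pathFunctor (fun a => Psh.{w} X (o a)) L S.tgt,
    S.cell = some θ ∧
    pathFunctor (fun a => Psh.{w} X (o a)) L S.src = star.{w} X (b := o b) A.src ∧
    pathFunctor (fun a => Psh.{w} X (o a)) L S.tgt = star.{w} X (b := o b) A.tgt ∧
    θ ≍ starMap.{w} X (a := o a) (b := o b) (f := A.src) (g := A.tgt) A.cell

variable {X o L}

theorem id_heq_id {A : Type*} [Category* A] {x y : A} (h : x = y) : 𝟙 x ≍ 𝟙 y := by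
  subst h
  rfl

theorem Tracks.one {a b : W} {p : Path a b} {f : o a ⟶ o b}
    (h : pathFunctor (fun a => Psh.{w} X (o a)) L p = star.{w} X f) :
    Tracks X o L (Total.one _ p) (Total.one C f) := by
  refine ⟨𝟙 _, rfl, h, h, ?_⟩
  refine HEq.trans ?_ (heq_of_eq (starMap_id (B := C.Obj) X f).symm)
  exact id_heq_id h

theorem Tracks.vc {a b : W} {S T : (functors (fun a => Psh.{w} X (o a)) L).withBot.Total a b}
    {A B : C.Total (o a) (o b)} (h : Tracks X o L S A) (h' : Tracks X o L T B)
    (e : S.tgt = T.src) (e' : A.tgt = B.src) : Tracks X o L (S ⬝ T) (A ⬝ B) := by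
  obtain ⟨p, q, S⟩ := S; obtain ⟨q', r, T⟩ := T
  obtain ⟨f, g, α⟩ := A; obtain ⟨g', k, β⟩ := B
  obtain rfl : q = q' := e
  obtain rfl : g = g' := e'
  obtain ⟨θ, hS, hf, hg, hθ⟩ := h
  obtain ⟨θ', hT, -, hk, hθ'⟩ := h'
  change pathFunctor _ _ p ⟶ pathFunctor _ _ q at θ
  change pathFunctor _ _ q ⟶ pathFunctor _ _ r at θ'
  obtain rfl : S = some θ := hS
  obtain rfl : T = some θ' := hT
  refine (congrArg₂ (Tracks X o L) (mk_vc_mk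
    (C := (functors (fun a => Psh.{w} X (o a)) L).withBot) (some θ) (some θ'))
    (mk_vc_mk (C := C) α β)).mpr ?_
  exact ⟨θ ≫ θ', rfl, hf, hk, (comp_heq_comp hf hg hk hθ hθ').trans
    (heq_of_eq (starMap_comp (B := C.Obj) X α β).symm)⟩

theorem hcomp_eq_vcomp {a b c : V} {f f' : Path a b} {g g' : Path b c} (α : C.Cell f f')
    (β : C.Cell g g') :
    C.hcomp α β = C.vcomp (C.hcomp (C.id f) β) (C.hcomp α (C.id g')) := by
  rw [← C.interchange, C.id_vcomp, C.vcomp_id]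

theorem Tracks.hc {a b c : W} {S : (functors (fun a => Psh.{w} X (o a)) L).withBot.Total a b}
    {T : (functors (fun a => Psh.{w} X (o a)) L).withBot.Total b c}
    {A : C.Total (o a) (o b)} {B : C.Total (o b) (o c)} (h : Tracks X o L S A)
    (h' : Tracks X o L T B) : Tracks X o L (S ⊠ T) (A ⊠ B) := by
  obtain ⟨p, q, S⟩ := S; obtain ⟨p', q', T⟩ := T
  obtain ⟨f, g, α⟩ := A; obtain ⟨f', g', β⟩ := B
  obtain ⟨θ, hS, hf, hg, hθ⟩ := h
  obtain ⟨θ', hT, hf', hg', hθ'⟩ := h'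
  change pathFunctor _ _ p ⟶ pathFunctor _ _ q at θ
  change pathFunctor _ _ p' ⟶ pathFunctor _ _ q' at θ'
  obtain rfl : S = some θ := hS
  obtain rfl : T = some θ' := hT
  refine ⟨pathHcomp _ L θ θ', rfl, ?_, ?_, ?_⟩
  · refine (pathFunctor_comp _ L p p').trans ?_
    refine Eq.trans ?_ (star_comp (B := C.Obj) X f f').symm
    exact congrArg₂ Functor.comp hf hf'
  · refine (pathFunctor_comp _ L q q').trans ?_
    refine Eq.trans ?_ (star_comp (B := C.Obj) X g g').symm
    exact congrArg₂ Functor.comp hg hg'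
  · refine (pathHcomp_heq _ L θ θ').trans ?_
    refine (natTrans_hcomp_heq hf hg hf' hg' hθ hθ').trans ?_
    refine (starMap_whisker (B := C.Obj) X α β).symm.trans (heq_of_eq ?_)
    exact congrArg (starMap.{w} (B := C.Obj) X) (hcomp_eq_vcomp α β).symm

/-- `S` determines the natural transformation, and Yoneda recovers the 2-cell from it once `b` is
sent to `X`. -/
theorem Tracks.eq {a b : W} {S : (functors (fun a => Psh.{w} X (o a)) L).withBot.Total a b}
    (hb : o b = X) {f g : o a ⟶ o b} {α β : f ⟶ g} (h : Tracks X o L S ⟨f, g, α⟩)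
    (h' : Tracks X o L S ⟨f, g, β⟩) : α = β := by
  subst hb
  obtain ⟨θ, hθ, hf, hg, hα⟩ := h
  obtain ⟨θ', hθ', -, -, hβ⟩ := h'
  obtain rfl : θ = θ' := Option.some.inj (hθ.symm.trans hθ')
  exact starMap_injective (B := C.Obj) (o b) (eq_of_heq (hα.symm.trans hβ))

end

/-! ### Adjunctions and zigzags -/

section

variable {W : Type u'} [Quiver.{v'} W] (M : W → Type m) [∀ a, Category.{n} (M a)]
  (L : ∀ {a b : W}, (a ⟶ b) → M a ⥤ M b)

theorem functors_left_triangle {a b : W} (y : b ⟶ a) (x : a ⟶ b) (adj : L y ⊣ L x) :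
    (functors M L).vcomp
      ((functors M L).hcomp (f := Path.nil) (f' := y.toPath.comp x.toPath) adj.unit
        ((functors M L).id y.toPath))
      ((functors M L).hcomp ((functors M L).id y.toPath) (g := x.toPath.comp y.toPath)
        (g' := Path.nil) adj.counit) = (functors M L).id y.toPath := by
  -- On these one- and two-letter paths the transports inside `pathHcomp` are between definitionally
  -- equal functors, so they can be displayed as identities; a triangle identity of `adj` remains.
  refine NatTrans.ext (funext fun G => ?_)
  change (𝟙 _ ≫ (𝟙 _ ≫ (L y).map (adj.unit.app G)) ≫ 𝟙 _) ≫
    (𝟙 _ ≫ (adj.counit.app ((L y).obj G) ≫ 𝟙 _) ≫ 𝟙 _) = 𝟙 ((L y).obj G)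
  simp

theorem functors_right_triangle {a b : W} (y : b ⟶ a) (x : a ⟶ b) (adj : L y ⊣ L x) :
    (functors M L).vcomp
      ((functors M L).hcomp ((functors M L).id x.toPath) (g := Path.nil)
        (g' := y.toPath.comp x.toPath) adj.unit)
      ((functors M L).hcomp (f := x.toPath.comp y.toPath) (f' := Path.nil) adj.counit
        ((functors M L).id x.toPath)) = (functors M L).id x.toPath := by
  refine NatTrans.ext (funext fun G => ?_)
  change (𝟙 _ ≫ (adj.unit.app ((L x).obj G) ≫ (L y ⋙ L x).map (𝟙 _)) ≫ 𝟙 _) ≫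
    (𝟙 _ ≫ (𝟙 _ ≫ (L x).map (adj.counit.app G)) ≫ 𝟙 _) = 𝟙 ((L x).obj G)
  simp

end

end PathTwoCat

/-! ### Evaluation of contexts -/

namespace TwoPolygraph

open PathTwoCat PathTwoCat.Total

local infixr:70 " ⊠ " => Total.hc
local infixr:65 " ⬝ " => Total.vc

section

variable {V : Type u} [Quiver.{v} V] {E : TwoPolygraph.{w} V} (C : PathTwoCat.{w'} V)
  (σ : ∀ {a b : V} {f g : Path a b}, E.Gen f g → C.Cell f g)

/-- The evaluation of a 2-cell with boundary. -/
def evalTotal {a b : V} (A : E.free.Total a b) : C.Total a b := ⟨A.src, A.tgt, eval C σ A.cell⟩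

theorem evalTotal_vc {a b : V} {A B : E.free.Total a b} (h : A.tgt = B.src) :
    evalTotal C σ (A ⬝ B) = evalTotal C σ A ⬝ evalTotal C σ B := by
  obtain ⟨f, g, α⟩ := A; obtain ⟨g', k, β⟩ := B
  obtain rfl : g = g' := h
  rw [mk_vc_mk]
  refine Eq.trans ?_ (mk_vc_mk (C := C) (eval C σ α) (eval C σ β)).symm
  exact congrArg (fun γ : C.Cell f k => (⟨f, k, γ⟩ : C.Total a b)) (eval_vcomp C σ α β)

theorem evalTotal_hc {a b c : V} (A : E.free.Total a b) (B : E.free.Total b c) :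
    evalTotal C σ (A ⊠ B) = evalTotal C σ A ⊠ evalTotal C σ B :=
  congrArg (fun γ : C.Cell _ _ => (⟨_, _, γ⟩ : C.Total a c)) (eval_hcomp C σ A.cell B.cell)

/-- The interpretation of the generators of `E[f ⇒ g]` which sends the metavariable to `α`. -/
def evalVar {a b : V} {f g : Path a b} (α : C.Cell f g) {c d : V} {h k : Path c d} :
    (E.adjoin f g).Gen h k → C.Cell h k
  | AdjoinGen.old β => σ β
  | AdjoinGen.var => α

theorem eval_eval_substVar {a b : V} {f g : Path a b} (α : E.free.Cell f g) {c d : V}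
    {h k : Path c d} (t : (E.adjoin f g).Term h k) :
    eval C σ (eval E.free (substVar α) (Quot.mk _ t : (E.adjoin f g).free.Cell h k)) =
      t.eval C (evalVar C σ (eval C σ α)) := by
  induction t with
  | gen β => cases β <;> rfl
  | id f => rfl
  | vcomp s t hs ht => exact (eval_vcomp C σ _ _).trans (congrArg₂ C.vcomp hs ht)
  | hcomp s t hs ht => exact (eval_hcomp C σ _ _).trans (congrArg₂ C.hcomp hs ht)

/-- The value of `K(α)` depends on `α` only through the value of `α`. Hence an interpretation that
validates the rules validates all rewriting steps. -/
theorem Context.eval_apply_congr {a b : V} {f g : Path a b} {c d : V} {h k : Path c d}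
    (K : E.Context f g h k) {α β : E.free.Cell f g} (e : eval C σ α = eval C σ β) :
    eval C σ (K.apply α) = eval C σ (K.apply β) := by
  obtain ⟨⟨t⟩, hK⟩ := K
  refine (eval_eval_substVar C σ α t).trans ?_
  rw [e]
  exact (eval_eval_substVar C σ β t).symm

end

end TwoPolygraph

/-! ### From zigzag equations to adjunctions -/

namespace CategoryTheory.Bicategory

variable {B : Type u} [Bicategory.{w, v} B] {a b : B} {f : a ⟶ b} {g : b ⟶ a}

theorem leftZigzag_eq (i : 𝟙 a ⟶ f ≫ g) (e : g ≫ f ⟶ 𝟙 b) :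
    leftZigzag i e = i ▷ f ≫ (α_ f g f).hom ≫ f ◁ e := by
  simp [leftZigzag, bicategoricalComp]

theorem rightZigzag_eq (i : 𝟙 a ⟶ f ≫ g) (e : g ≫ f ⟶ 𝟙 b) :
    rightZigzag i e = g ◁ i ≫ (α_ g f g).inv ≫ e ▷ g := by
  simp [rightZigzag, bicategoricalComp]

end CategoryTheory.Bicategory

namespace PathTwoCat

open Bicategory

section

variable {V : Type u} [Quiver.{v} V] (C : PathTwoCat.{w} V)

/-- Two 2-cells satisfying the zigzag equations form an adjunction. -/
def adjunction {a b : V} {y : b ⟶ a} {x : a ⟶ b}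
    (i : C.Cell (Path.nil : Path b b) (y.toPath.comp x.toPath))
    (e : C.Cell (x.toPath.comp y.toPath) (Path.nil : Path a a))
    (hl : C.vcomp (C.hcomp (f := Path.nil) (f' := y.toPath.comp x.toPath) i (C.id y.toPath))
      (C.hcomp (C.id y.toPath) (g := x.toPath.comp y.toPath) (g' := Path.nil) e) =
      C.id y.toPath)
    (hr : C.vcomp (C.hcomp (C.id x.toPath) (g := Path.nil) (g' := y.toPath.comp x.toPath) i)
      (C.hcomp (f := x.toPath.comp y.toPath) (f' := Path.nil) e (C.id x.toPath)) =
      C.id x.toPath) :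
    Bicategory.Adjunction (B := C.Obj) (a := b) (b := a) y.toPath x.toPath where
  unit := i
  counit := e
  left_triangle :=
    -- The associator and unitors on these short paths compute to identities, which `id_vcomp`
    -- removes.
    (leftZigzag_eq (B := C.Obj) (f := y.toPath) (g := x.toPath) i e).trans
      ((congrArg (C.vcomp (h := y.toPath) _) (C.id_vcomp (g := y.toPath) _)).trans
        (hl.trans (C.id_vcomp _).symm))
  right_triangle :=
    (rightZigzag_eq (B := C.Obj) (f := y.toPath) (g := x.toPath) i e).trans
      ((congrArg (C.vcomp (h := x.toPath) _) (C.id_vcomp (g := x.toPath) _)).trans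
        (hr.trans (C.id_vcomp _).symm))

end

end PathTwoCat

/-! ### Truncated rule sets and models in presheaf categories -/

namespace FormalAdj

open PathTwoCat PathTwoCat.Total TwoPolygraph Bicategory

local infixr:70 " ⊠ " => Total.hc
local infixr:65 " ⬝ " => Total.vc

section

variable {V : Type u} [Quiver.{v} V]

/-- `f^n ↦ f^(n+1)`. -/
def succ {A B : FormalAdj V} : (A ⟶ B) → (B ⟶ A)
  | .even f n hn => .odd f (n + 1) hn.add_one
  | .odd f n hn => .even f (n + 1) hn.add_one

theorem succ_pred {A B : FormalAdj V} : ∀ x : A ⟶ B, succ (pred x) = x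
  | .even f n hn => by
    change Arrow.even f (n - 1 + 1) _ = _
    congr 1
    omega
  | .odd f n hn => by
    change Arrow.odd f (n - 1 + 1) _ = _
    congr 1
    omega

variable (E : TwoPolygraph.{w} V)

/-- The winding number of the 1-generator of a 3-generator. -/
def ruleWind {E : TwoPolygraph.{w} V} {A B : FormalAdj V} {f g : Path A B}
    {α β : (twoPolygraph E).free.Cell f g} : Gen₃ E α β → ℤ
  | .l x => wind x
  | .r x => wind x

/-- The 3-polygraph of formal adjoints, with only the rules for the 1-generators whose winding
number lies in `(-N, N]`. -/
abbrev truncated (N : ℕ) : ThreePolygraph (FormalAdj V) where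
  toTwoPolygraph := twoPolygraph E
  Gen₃ α β := {r : Gen₃ E α β // -(N : ℤ) < ruleWind r ∧ ruleWind r ≤ N}

variable {E}

theorem truncated_step_mono {M N : ℕ} (h : M ≤ N) {A B : FormalAdj V} {f g : Path A B}
    {α β : (polygraph E).free.Cell f g} (s : (truncated E M).Step α β) :
    (truncated E N).Step α β := by
  obtain ⟨⟨r, hr⟩, K⟩ := s
  exact .mk (F := truncated E N) ⟨r, by omega, by omega⟩ K

theorem exists_truncated_step {A B : FormalAdj V} {f g : Path A B}
    {α β : (polygraph E).free.Cell f g} (s : (polygraph E).Step α β) :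
    ∃ N, (truncated E N).Step α β := by
  obtain ⟨r, K⟩ := s
  exact ⟨(ruleWind r).natAbs + 1, .mk (F := truncated E _) ⟨r, by omega, by omega⟩ K⟩

/-- An equality of classes is witnessed by a finite chain of steps, and finitely many rules have
bounded winding number. -/
theorem exists_truncated_mk_eq {A B : FormalAdj V} {f g : Path A B}
    {α β : (polygraph E).free.Cell f g}
    (h : (Quot.mk _ α : (polygraph E).presented.Cell f g) = Quot.mk _ β) :
    ∃ N, (Quot.mk _ α : (truncated E N).presented.Cell f g) = Quot.mk _ β := by
  induction Quot.eqvGen_exact h with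
  | rel α β s =>
    obtain ⟨N, hN⟩ := exists_truncated_step s
    exact ⟨N, Quot.sound hN⟩
  | refl α => exact ⟨0, rfl⟩
  | symm α β s ih =>
    obtain ⟨N, hN⟩ := ih (Quot.eqvGen_sound s)
    exact ⟨N, hN.symm⟩
  | trans α β γ s t ih ih' =>
    obtain ⟨M, hM⟩ := ih (Quot.eqvGen_sound s)
    obtain ⟨N, hN⟩ := ih' (Quot.eqvGen_sound t)
    have mono : ∀ {K : ℕ} (_ : K ≤ max M N) {α β : (polygraph E).free.Cell f g},
        (Quot.mk _ α : (truncated E K).presented.Cell f g) = Quot.mk _ β →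
        (Quot.mk _ α : (truncated E (max M N)).presented.Cell f g) = Quot.mk _ β :=
      fun hK _ _ h => congrArg (Quot.map id fun _ _ => truncated_step_mono hK) h
    exact ⟨max M N, (mono (le_max_left M N) hM).trans (mono (le_max_right M N) hN)⟩

/-! ### Interpretation in functors between presheaf categories -/

section

variable {W : Type u'} [Quiver.{v'} W] {C : PathTwoCat.{max u' v' w'} W}

/-- An interpretation of `E` in `C`, compatible with an assignment `L` of functors between
categories of presheaves to the 1-generators `f^n`. -/
structure Model (E : TwoPolygraph.{w} V) (X : C.Obj) (o : V → C.Obj)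
    (L : ∀ {A B : FormalAdj V}, (A ⟶ B) → Psh.{w'} X (o A) ⥤ Psh.{w'} X (o B)) where
  map : ∀ {A B : V}, Path A B → (o A ⟶ o B)
  map_nil : ∀ A : V, map (Path.nil : Path A A) = 𝟙 (o A)
  map_cons : ∀ {A B D : V} (f : Path A B) (y : B ⟶ D), map (f.cons y) = map f ≫ map y.toPath
  map_letter : ∀ {A B : V} (y : A ⟶ B), L ((zero V).map y) = star.{w'} X (map y.toPath)
  cell : ∀ {A B : V} {f g : Path A B}, E.Term f g → C.Cell (map f) (map g)
  cell_id : ∀ {A B : V} (f : Path A B), cell (.id f) = C.id (map f)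
  cell_vcomp : ∀ {A B : V} {f g h : Path A B} (s : E.Term f g) (t : E.Term g h),
    cell (s.vcomp t) = C.vcomp (cell s) (cell t)
  cell_hcomp : ∀ {A B D : V} {f f' : Path A B} {g g' : Path B D} (s : E.Term f f')
    (t : E.Term g g'), (⟨_, _, cell (s.hcomp t)⟩ : C.Total (o A) (o D)) =
      (⟨_, _, cell s⟩ : C.Total (o A) (o B)) ⊠ (⟨_, _, cell t⟩ : C.Total (o B) (o D))

namespace Model

variable {X : C.Obj} {o : V → C.Obj}
  {L : ∀ {A B : FormalAdj V}, (A ⟶ B) → Psh.{w'} X (o A) ⥤ Psh.{w'} X (o B)}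
  (M : Model E X o L)

theorem pathFunctor_mapPath_zero {A B : V} (f : Path A B) :
    pathFunctor (V := FormalAdj V) (fun A => Psh.{w'} X (o A)) L ((zero V).mapPath f) =
      star.{w'} X (M.map f) := by
  induction f with
  | nil => exact (star_id (B := C.Obj) X _).symm.trans (congrArg _ (M.map_nil A).symm)
  | cons f y ih =>
    refine (congrArg₂ Functor.comp ih (M.map_letter y)).trans ?_
    exact (star_comp (B := C.Obj) X _ _).symm.trans (congrArg _ (M.map_cons f y).symm)

open Classical in
/-- The interpretation of the 2-generators of `F`: those of `E` act through `C`, the units and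
counits are those of chosen adjunctions, if there are any. -/
noncomputable def interp {A B : FormalAdj V} {p q : Path A B} : (polygraph E).Gen p q →
    (functors (V := FormalAdj V) (fun A => Psh.{w'} X (o A)) L).withBot.Cell p q
  | Gen₂.base (f := f) (g := g) α =>
    some (eqToHom (M.pathFunctor_mapPath_zero f) ≫
      starMap.{w'} (B := C.Obj) X (M.cell (.gen α)) ≫
      eqToHom (M.pathFunctor_mapPath_zero g).symm)
  -- The absorbing value `none` makes the interpretation total where no adjunction exists;
  -- `eval_rule` assumes the adjunctions that its rule needs.
  | Gen₂.unit x =>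
    if h : Nonempty (L (pred x) ⊣ L x) then some h.some.unit else none
  | Gen₂.counit x =>
    if h : Nonempty (L (pred x) ⊣ L x) then some h.some.counit else none

/-- However the units and counits are interpreted, `t^0` contains none of them and acts by
precomposition with `M.cell t`. -/
theorem tracks {A B : V} {f g : Path A B} (t : E.Term f g) :
    Tracks (W := FormalAdj V) X o L
      (evalTotal _ M.interp (zeroTotal (Quot.mk _ t : E.free.Cell f g))) ⟨_, _, M.cell t⟩ := by
  induction t with
  | gen α =>
    exact ⟨_, rfl, M.pathFunctor_mapPath_zero _, M.pathFunctor_mapPath_zero _,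
      eqToHom_conj_heq _ _ _⟩
  | id f =>
    rw [M.cell_id]
    exact Tracks.one (M.pathFunctor_mapPath_zero f)
  | vcomp s t hs ht =>
    have h := hs.vc ht rfl rfl
    have e : evalTotal _ M.interp (zeroTotal (Quot.mk _ (s.vcomp t) : E.free.Cell _ _)) =
        evalTotal _ M.interp (zeroTotal (Quot.mk _ s : E.free.Cell _ _)) ⬝
          evalTotal _ M.interp (zeroTotal (Quot.mk _ t : E.free.Cell _ _)) :=
      (congrArg (evalTotal _ M.interp) (liftTotal_vcomp (zero V) (polygraph E).free
        (fun α => (polygraph E).of (Gen₂.base α)) (Quot.mk _ s) (Quot.mk _ t))).trans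
        (evalTotal_vc _ _ (A := zeroTotal (Quot.mk _ s : E.free.Cell _ _))
          (B := zeroTotal (Quot.mk _ t : E.free.Cell _ _)) rfl)
    rw [M.cell_vcomp]
    exact (congrArg₂ (Tracks (W := FormalAdj V) X o L) e
      (mk_vc_mk (C := C) (M.cell s) (M.cell t)).symm).mpr h
  | hcomp s t hs ht =>
    have h := hs.hc ht
    have e : evalTotal _ M.interp (zeroTotal (Quot.mk _ (s.hcomp t) : E.free.Cell _ _)) =
        evalTotal _ M.interp (zeroTotal (Quot.mk _ s : E.free.Cell _ _)) ⊠
          evalTotal _ M.interp (zeroTotal (Quot.mk _ t : E.free.Cell _ _)) :=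
      (congrArg (evalTotal _ M.interp) (liftTotal_hcomp (zero V) (polygraph E).free
        (fun α => (polygraph E).of (Gen₂.base α)) (Quot.mk _ s) (Quot.mk _ t))).trans
        (evalTotal_hc _ _ (zeroTotal (Quot.mk _ s : E.free.Cell _ _))
          (zeroTotal (Quot.mk _ t : E.free.Cell _ _)))
    rw [M.cell_hcomp]
    exact e ▸ h

/-- The rules `l` and `r` become the two triangle identities of the chosen adjunction; the same
choice is used for unit and counit. -/
theorem eval_rule {A B : FormalAdj V} {f g : Path A B} {α β : (twoPolygraph E).free.Cell f g}
    (r : Gen₃ E α β) (h : ∀ {A B : FormalAdj V} (x : A ⟶ B), wind x = ruleWind r →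
      Nonempty (L (pred x) ⊣ L x)) :
    eval _ M.interp α = eval _ M.interp β := by
  cases r with
  | l x =>
    have hu : M.interp (.unit x) = some (h x rfl).some.unit := dif_pos _
    have hc : M.interp (.counit x) = some (h x rfl).some.counit := dif_pos _
    change PathTwoCat.vcomp _ (PathTwoCat.hcomp _ (f := Path.nil)
      (f' := (pred x).toPath.comp x.toPath) (M.interp (.unit x)) (PathTwoCat.id _ (pred x).toPath))
      (PathTwoCat.hcomp _ (PathTwoCat.id _ (pred x).toPath) (g := x.toPath.comp (pred x).toPath)
        (g' := Path.nil) (M.interp (.counit x))) = PathTwoCat.id _ (pred x).toPath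
    rw [hu, hc]
    exact congrArg some (functors_left_triangle _ L (pred x) x (h x rfl).some)
  | r x =>
    have hu : M.interp (.unit x) = some (h x rfl).some.unit := dif_pos _
    have hc : M.interp (.counit x) = some (h x rfl).some.counit := dif_pos _
    change PathTwoCat.vcomp _ (PathTwoCat.hcomp _ (PathTwoCat.id _ x.toPath) (g := Path.nil)
      (g' := (pred x).toPath.comp x.toPath) (M.interp (.unit x)))
      (PathTwoCat.hcomp _ (f := x.toPath.comp (pred x).toPath) (f' := Path.nil)
        (M.interp (.counit x)) (PathTwoCat.id _ x.toPath)) = PathTwoCat.id _ x.toPath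
    rw [hu, hc]
    exact congrArg some (functors_right_triangle _ L (pred x) x (h x rfl).some)

/-- With an adjunction for every rule of `truncated E N`, evaluation factors through the presented
2-category. Cells with the same class then act equally, and `Tracks.eq` turns this into an equality
in `C`. -/
theorem cell_eq {N : ℕ} (h : ∀ {A B : FormalAdj V} (x : A ⟶ B), -(N : ℤ) < wind x → wind x ≤ N →
      Nonempty (L (pred x) ⊣ L x)) {A B : V} (hB : o B = X) {f g : Path A B} (s t : E.Term f g)
    (e : (truncated E N).classTotal (zeroTotal (Quot.mk _ s : E.free.Cell f g)) =
      (truncated E N).classTotal (zeroTotal (Quot.mk _ t : E.free.Cell f g))) :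
    M.cell s = M.cell t := by
  have key : ∀ {A B : FormalAdj V} {p q : Path A B} (α β : (truncated E N).free.Cell p q),
      (truncated E N).Step α β → eval _ M.interp α = eval _ M.interp β := by
    rintro A B p q _ _ ⟨⟨r, hr⟩, K⟩
    refine K.eval_apply_congr _ _ (M.eval_rule r fun x hx => h x ?_ ?_) <;> omega
  have e' := congrArg (Quot.lift (eval _ M.interp) key) (eq_of_heq (heq_of_mk_eq e))
  refine Tracks.eq.{w', v', max u v, u', u} (W := FormalAdj V) hB (M.tracks s) ?_
  refine (congrArg (fun Z => Tracks (W := FormalAdj V) X o L ⟨_, _, Z⟩ _) e').mpr (M.tracks t)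

end Model

end

end

end FormalAdj

/-! ### Kan extensions as additional adjoints -/

namespace CategoryTheory.Bicategory

variable {B : Type u} [Bicategory.{max v w, v} B] (X : B) {a b : B} (f : a ⟶ b)

/-- The right adjoint of `star X f`. -/
noncomputable abbrev ranStar : Psh.{w} X b ⥤ Psh.{w} X a := (precomp X f).ran

/-- The left adjoint of `star X f`. -/
noncomputable abbrev lanStar : Psh.{w} X b ⥤ Psh.{w} X a := (precomp X f).lan

/-- `star X f` is left adjoint to right Kan extension. -/
noncomputable def starRanAdjunction : star.{w} X f ⊣ ranStar.{w} X f :=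
  (precomp X f).ranAdjunction _

/-- Left Kan extension is left adjoint to `star X f`. -/
noncomputable def lanStarAdjunction : lanStar.{w} X f ⊣ star.{w} X f :=
  (precomp X f).lanAdjunction _

end CategoryTheory.Bicategory

/-! ### Faithfulness by induction on the truncation -/

namespace FormalAdj

open PathTwoCat PathTwoCat.Total TwoPolygraph Bicategory

local infixr:70 " ⊠ " => Total.hc
local infixr:65 " ⬝ " => Total.vc

section

variable {V : Type u} [Quiver.{v} V] {E : TwoPolygraph.{w} V}

/-- The identity context. -/
def idContext {A B : FormalAdj V} (f g : Path A B) : (twoPolygraph E).Context f g f g where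
  cell := ((twoPolygraph E).adjoin f g).of AdjoinGen.var
  weight_var := rfl

theorem mk_eq_of_rule {N : ℕ} {A B : FormalAdj V} {f g : Path A B}
    {α β : (twoPolygraph E).free.Cell f g} (r : Gen₃ E α β) (h : -(N : ℤ) < ruleWind r)
    (h' : ruleWind r ≤ N) :
    (Quot.mk _ α : (truncated E N).presented.Cell f g) = Quot.mk _ β :=
  Quot.sound (.mk (F := truncated E N) ⟨r, h, h'⟩ (idContext f g))

/-- If the rules for `x` are present, then `pred x` is left adjoint to `x`. -/
def truncatedAdjunction {N : ℕ} {A B : FormalAdj V} (x : A ⟶ B) (h : -(N : ℤ) < wind x)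
    (h' : wind x ≤ N) :
    Bicategory.Adjunction (B := (truncated E N).presented.Obj) (a := B) (b := A)
      (pred x).toPath x.toPath :=
  (truncated E N).presented.adjunction (y := pred x) (x := x) (Quot.mk _ (η E x))
    (Quot.mk _ (FormalAdj.ε E x)) (mk_eq_of_rule (.l x) h h') (mk_eq_of_rule (.r x) h h')

variable (N : ℕ) (X : (truncated E N).presented.Obj)

/-- The functors between presheaf categories by which the 1-generators of winding number at most
`N + 1` in absolute value act: for winding number at most `N`, precomposition in the 2-category
presented by the rules for `(-N, N]`, and Kan extensions beyond. -/
noncomputable def kanFunctor {A B : FormalAdj V} (x : A ⟶ B) :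
    Psh.{w} (B := (truncated E N).presented.Obj) X A ⥤
      Psh.{w} (B := (truncated E N).presented.Obj) X B :=
  if wind x = N + 1 then
    ranStar.{w} (B := (truncated E N).presented.Obj) (a := B) (b := A) X (pred x).toPath
  else if wind x = -(N + 1) then
    lanStar.{w} (B := (truncated E N).presented.Obj) (a := B) (b := A) X (succ x).toPath
  -- This branch also covers winding numbers beyond `N + 1` in absolute value, where the choice is
  -- immaterial: no rule of `truncated E (N + 1)` involves them.
  else star.{w} (B := (truncated E N).presented.Obj) (a := A) (b := B) X x.toPath

variable {N X}

theorem kanFunctor_of_wind_eq {A B : FormalAdj V} {x : A ⟶ B} (h : wind x = N + 1) :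
    kanFunctor (E := E) N X x =
      ranStar.{w} (B := (truncated E N).presented.Obj) (a := B) (b := A) X (pred x).toPath :=
  if_pos h

theorem kanFunctor_of_wind_eq_neg {A B : FormalAdj V} {x : A ⟶ B} (h : wind x = -(N + 1)) :
    kanFunctor (E := E) N X x =
      lanStar.{w} (B := (truncated E N).presented.Obj) (a := B) (b := A) X (succ x).toPath :=
  (if_neg (by omega)).trans (if_pos h)

theorem kanFunctor_of_le {A B : FormalAdj V} {x : A ⟶ B} (h : -(N : ℤ) ≤ wind x)
    (h' : wind x ≤ N) :
    kanFunctor (E := E) N X x =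
      star.{w} (B := (truncated E N).presented.Obj) (a := A) (b := B) X x.toPath :=
  (if_neg (by omega)).trans (if_neg (by omega))

/-- Inside `(-N, N]` the rules already present give the adjunction. At `wind x = N + 1`, `x` acts by
the right Kan extension adjoint to `pred x`. At `wind x = -N`, it is `pred x` that acts by the left
Kan extension adjoint to `x`. -/
theorem nonempty_kanFunctor_adjunction {A B : FormalAdj V} (x : A ⟶ B)
    (h : -((N + 1 : ℕ) : ℤ) < wind x) (h' : wind x ≤ (N + 1 : ℕ)) :
    Nonempty (kanFunctor (E := E) N X (pred x) ⊣ kanFunctor (E := E) N X x) := by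
  push_cast at h h'
  have hp := wind_pred x
  by_cases h₁ : wind x = N + 1
  · rw [kanFunctor_of_wind_eq h₁, kanFunctor_of_le (by omega) (by omega)]
    exact ⟨starRanAdjunction (B := (truncated E N).presented.Obj) X _⟩
  by_cases h₂ : wind x = -N
  · rw [kanFunctor_of_le (x := x) (by omega) (by omega), kanFunctor_of_wind_eq_neg (by omega),
      succ_pred]
    exact ⟨lanStarAdjunction (B := (truncated E N).presented.Obj) X _⟩
  rw [kanFunctor_of_le (x := x) (by omega) (by omega), kanFunctor_of_le (by omega) (by omega)]
  exact ⟨starAdjunction X (truncatedAdjunction x (by omega) (by omega))⟩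

variable (N X) in
/-- The action of `E` by precomposition in the 2-category presented by the rules for `(-N, N]`. -/
noncomputable def kanModel :
    Model.{w, w} (C := (truncated E N).presented) E X (fun A => A) (kanFunctor N X) where
  map f := (zero V).mapPath f
  map_nil _ := rfl
  map_cons _ _ := rfl
  map_letter y := kanFunctor_of_le (by simp) (by simp)
  cell t := ((truncated E N).classTotal (zeroTotal (Quot.mk _ t : E.free.Cell _ _))).cell
  cell_id _ := rfl
  cell_vcomp s t := congrArg (Quot.mk _) (eval_vcomp ((polygraph E).free.comap (zero V)) _
    (Quot.mk _ s) (Quot.mk _ t))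
  cell_hcomp s t := congrArg (truncated E N).classTotal (liftTotal_hcomp (zero V)
    (polygraph E).free (fun α => (polygraph E).of (Gen₂.base α)) (Quot.mk _ s) (Quot.mk _ t))

/-- Functors between presheaf categories extending the action of `E` by precomposition in `E^*`. -/
noncomputable def freeFunctor (X : E.free.Obj) {A B : FormalAdj V} : (A ⟶ B) →
    (Psh.{w} (B := E.free.Obj) X A ⥤ Psh.{w} (B := E.free.Obj) X B)
  | .even f _ _ => star.{w} (B := E.free.Obj) X f.toPath
  -- Only the letters `f^0` are constrained, by `map_letter`; the other values are arbitrary, as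
  -- `truncated E 0` has no rules.
  | .odd f _ _ => ranStar.{w} (B := E.free.Obj) X f.toPath

/-- The action of `E` by precomposition in `E^*`. -/
noncomputable def freeModel (X : E.free.Obj) :
    Model.{w, w} (C := E.free) E X (fun A => A) (freeFunctor X) where
  map f := f
  map_nil _ := rfl
  map_cons _ _ := rfl
  map_letter _ := rfl
  cell t := Quot.mk _ t
  cell_id _ := rfl
  cell_vcomp _ _ := rfl
  cell_hcomp _ _ := rfl

/-- Descent on `N`: `kanModel` satisfies the rules at level `N + 1` but takes values at level `N`,
and `freeModel` passes from level `0` to `E^*`. The presheaves are based at the common target `B`,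
as Yoneda requires. -/
theorem eq_of_truncated_mk_eq {A B : V} {f g : Path A B} (s t : E.Term f g) : ∀ {N : ℕ},
    (truncated E N).classTotal (zeroTotal (Quot.mk _ s : E.free.Cell f g)) =
      (truncated E N).classTotal (zeroTotal (Quot.mk _ t : E.free.Cell f g)) →
    (Quot.mk _ s : E.free.Cell f g) = Quot.mk _ t
  | 0, h => (freeModel (E := E) B).cell_eq (fun x h h' => by omega) rfl s t h
  | N + 1, h => by
    have := (kanModel (E := E) N B).cell_eq nonempty_kanFunctor_adjunction rfl s t h
    exact eq_of_truncated_mk_eq s t (N := N)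
      (congrArg (fun α => (⟨_, _, α⟩ : (truncated E N).presented.Total A B)) this)

theorem embedding_map₂_injective {A B : E.free.Obj} {f g : A ⟶ B} {α β : f ⟶ g}
    (h : (embedding E).map₂ α = (embedding E).map₂ β) : α = β := by
  rw [embedding_map₂, embedding_map₂] at h
  obtain ⟨s⟩ := α
  obtain ⟨t⟩ := β
  obtain ⟨N, hN⟩ := exists_truncated_mk_eq h
  exact eq_of_truncated_mk_eq s t (N := N)
    (congrArg (fun α => (⟨_, _, α⟩ : (truncated E N).presented.Total A B)) hN)

end

end FormalAdj

theorem mainTheorem2 {V : Type u} [Quiver.{v} V] (E : TwoPolygraph.{w} V) :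
    (∀ (A B : E.free.Obj) (f g : A ⟶ B)
      (α : (FormalAdj.toFree E).map f ⟶ (FormalAdj.toFree E).map g),
      (FormalAdj.polygraph E).IsNormalForm α → FormalAdj.unitCounitCount α = 0) ∧
    (∀ (A B : E.free.Obj) (f g : A ⟶ B),
      Set.BijOn (fun α : f ⟶ g => (FormalAdj.toFree E).map₂ α) Set.univ
        {α | (FormalAdj.polygraph E).IsNormalForm α}) ∧
    (∀ A B : E.free.Obj,
      ((FormalAdj.embedding E).mapFunctor A B).Full ∧
      ((FormalAdj.embedding E).mapFunctor A B).Faithful) := by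
  refine ⟨fun A B f g α => (FormalAdj.isNormalForm_iff α).1, fun A B f g => ⟨?_, ?_, ?_⟩,
    fun A B => ⟨⟨?_⟩, ⟨?_⟩⟩⟩
  · exact fun α _ => (FormalAdj.isNormalForm_iff _).2 (FormalAdj.unitCounitCount_map₂_toFree α)
  · intro α _ β _ h
    -- Injectivity into `F_2^*` follows from the stronger injectivity into its quotient.
    refine FormalAdj.embedding_map₂_injective ?_
    rw [FormalAdj.embedding_map₂, FormalAdj.embedding_map₂]
    exact congrArg (Quot.mk _) h
  · intro α hα
    obtain ⟨β, hβ⟩ := FormalAdj.exists_map₂_toFree_eq α ((FormalAdj.isNormalForm_iff α).1 hα)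
    exact ⟨β, trivial, hβ⟩
  · rintro f g ⟨α⟩
    exact FormalAdj.exists_embedding_map₂_eq _ α rfl
  · exact fun h => FormalAdj.embedding_map₂_injective h
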